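/- **Theorem (General quantum central limit theorem).** Let $m$ be the number of modes and let $\hat Q=(\hat X_1,\hat P_1,\dots,\hat X_m,\hat P_m)$ be the canonical position and momentum operators on $L^2(\mathbb R^m)$, $(\hat X_j\psi)(x)=x_j\psi(x)$ and $\hat P_j=-i\,\partial_{x_j}$. For $r\in\mathbb R^{2m}$ let $D_r=\exp\big(i\sum_k r_k\hat Q_k\big)$ be the displacement operator, and for a trace class operator $\tau$ let $\chi_\tau(r)=\operatorname{tr}(D_r\tau)$ be its characteristic function. For a positive operator $\tau$ of unit trace with finite second moments (every $\hat Q_k\sqrt\tau$ is an everywhere defined Hilbert–Schmidt operator), the first moments are $[d_\tau]_k=\operatorname{tr}(\hat Q_k\tau)$ and the covariance matrix is $[\Gamma_\tau]_{j,k}=2\,\mathrm{Re}\operatorname{tr}\big[(\hat Q_j-[d_\tau]_j)(\hat Q_k-[d_\tau]_k)\tau\big]$, where the traces are understood as $\operatorname{tr}(\sqrt\tau\,\hat Q_k\sqrt\tau)$ and $\operatorname{tr}\big[\sqrt\tau(\hat Q_j-[d_\tau]_j)(\hat Q_k-[d_\tau]_k)\sqrt\tau\big]$, the latter being the Hilbert–Schmidt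 inner product of $(\hat Q_j-[d_\tau]_j)\sqrt\tau$ and $(\hat Q_k-[d_\tau]_k)\sqrt\tau$. Let $(\tau_N)_{N\ge 1}$ be a central limit sequence, that is, a sequence of Hermitian positive operators of unit trace on $L^2(\mathbb R^m)$ such that $$\chi_{\tau_N}(r)=\chi_{\tau_1}\!\left(\frac{r}{\sqrt N}\right)^{N}\qquad\text{for all } N\ge 1,\ r\in\mathbb R^{2m},$$ where $\tau_1$ has finite second moments and zero first moments. Then for every finite radius $r_0$ and every $\epsilon>0$ there is an $N_\epsilon$ such that for all $N\ge N_\epsilon$ and all $r\in\mathbb R^{2m}$ with $|r|\le r_0$, $$\big|\chi_{\tau_N}(r)-\chi_{\tau_\infty}(r)\big|<\epsilon ,\qquad\text{where}\quad \chi_{\tau_\infty}(r)=\exp\!\left(-\tfrac14\, r^{T}\Gamma_{\tau_1}r\right)$$ is the Gaussian characteristic function with zero first moments and covariance matrix $\Gamma_{\tau_1}$. -/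

import Mathlib

namespace QuantumCLT

open MeasureTheory
open scoped ContDiff InnerProductSpace

noncomputable section

/-- The configuration space `ℝᵐ` of `m` modes. -/
abbrev Config (m : ℕ) : Type := EuclideanSpace ℝ (Fin m)

/-- The Hilbert space `L²(ℝᵐ; ℂ)` of `m` modes (Schrödinger representation). -/
abbrev ModeSpace (m : ℕ) : Type := Lp ℂ 2 (volume : Measure (Config m))

/-- Phase space `ℝ²ᵐ` with its Euclidean norm. The coordinate `(j, 0)` belongs to the position
quadrature `X_j`, the coordinate `(j, 1)` to the momentum quadrature `P_j`; the lexicographic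
order of the index set is the order `X_1, P_1, …, X_m, P_m`. -/
abbrev PhaseSpace (m : ℕ) : Type := EuclideanSpace ℝ (Fin m × Fin 2)

/-! ### Quadrature operators -/

/-- The graph of the position operator `(X_j ψ)(x) = x_j ψ(x)` on its maximal domain
`{ψ ∈ L² : x_j ψ ∈ L²}`. -/
def positionGraph {m : ℕ} (j : Fin m) : Submodule ℂ (ModeSpace m × ModeSpace m) where
  carrier := {p | ∀ᵐ x : Config m, p.2 x = (x j : ℂ) * p.1 x}
  zero_mem' := by
    have h := Lp.coeFn_zero ℂ 2 (volume : Measure (Config m))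
    show ∀ᵐ x : Config m, (0 : ModeSpace m) x = (x j : ℂ) * (0 : ModeSpace m) x
    filter_upwards [h] with x hx
    rw [hx, Pi.zero_apply, mul_zero]
  add_mem' := by
    intro p q hp hq
    show ∀ᵐ x : Config m, (p.2 + q.2) x = (x j : ℂ) * (p.1 + q.1) x
    filter_upwards [hp, hq, Lp.coeFn_add p.1 q.1, Lp.coeFn_add p.2 q.2] with x h1 h2 h3 h4
    rw [h3, h4, Pi.add_apply, Pi.add_apply, h1, h2]
    ring
  smul_mem' := by
    intro c p hp
    show ∀ᵐ x : Config m, (c • p.2) x = (x j : ℂ) * (c • p.1) x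
    filter_upwards [hp, Lp.coeFn_smul c p.1, Lp.coeFn_smul c p.2] with x h1 h3 h4
    rw [h3, h4, Pi.smul_apply, Pi.smul_apply, h1, smul_eq_mul, smul_eq_mul]
    ring

/-- Elements of `L²` are integrable against a continuous function of compact support. -/
theorem integrable_test_mul {m : ℕ} (g : Config m → ℝ) (hg : Continuous g)
    (hs : HasCompactSupport g) (ψ : ModeSpace m) :
    Integrable (fun x : Config m => (g x : ℂ) * ψ x) := by
  have h := ((Lp.memLp ψ).locallyIntegrable (by norm_num)).integrable_smul_left_of_hasCompactSupport
    hg hs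
  simpa [Complex.real_smul] using h

theorem hasCompactSupport_partial {m : ℕ} (j : Fin m) {g : Config m → ℝ}
    (hs : HasCompactSupport g) :
    HasCompactSupport (fun x => fderiv ℝ g x (EuclideanSpace.single j 1)) :=
  (hs.fderiv (𝕜 := ℝ)).comp_left (g := fun L : Config m →L[ℝ] ℝ => L (EuclideanSpace.single j 1))
    (by simp)

theorem continuous_partial {m : ℕ} (j : Fin m) {g : Config m → ℝ} (hg : ContDiff ℝ ∞ g) :
    Continuous (fun x => fderiv ℝ g x (EuclideanSpace.single j 1)) :=
  (hg.continuous_fderiv (by simp)).clm_apply continuous_const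

/-- The graph of the momentum operator `P_j ψ = -i ∂_j ψ` on its maximal domain, that is, on all
`ψ ∈ L²` whose weak derivative `∂_j ψ` lies in `L²`. -/
def momentumGraph {m : ℕ} (j : Fin m) : Submodule ℂ (ModeSpace m × ModeSpace m) where
  carrier := {p | ∀ g : Config m → ℝ, ContDiff ℝ ∞ g → HasCompactSupport g →
    ∫ x, (g x : ℂ) * p.2 x =
      Complex.I * ∫ x, (fderiv ℝ g x (EuclideanSpace.single j 1) : ℂ) * p.1 x}
  zero_mem' := by
    intro g _ _
    have h := Lp.coeFn_zero ℂ 2 (volume : Measure (Config m))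
    have h1 : ∀ f : Config m → ℂ, ∫ x, f x * (0 : ModeSpace m) x = 0 := by
      intro f
      refine integral_eq_zero_of_ae ?_
      filter_upwards [h] with x hx
      rw [hx, Pi.zero_apply, mul_zero]
    show ∫ x, (g x : ℂ) * (0 : ModeSpace m) x =
      Complex.I * ∫ x, (fderiv ℝ g x (EuclideanSpace.single j 1) : ℂ) * (0 : ModeSpace m) x
    rw [h1, h1 (fun x => (fderiv ℝ g x (EuclideanSpace.single j 1) : ℂ)), mul_zero]
  add_mem' := by
    intro p q hp hq g hg hs
    have key : ∀ (f : Config m → ℝ), Continuous f → HasCompactSupport f →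
        ∀ φ ψ : ModeSpace m, ∫ x, (f x : ℂ) * (φ + ψ) x =
          (∫ x, (f x : ℂ) * φ x) + ∫ x, (f x : ℂ) * ψ x := by
      intro f hf hfs φ ψ
      rw [← integral_add (integrable_test_mul f hf hfs φ) (integrable_test_mul f hf hfs ψ)]
      refine integral_congr_ae ?_
      filter_upwards [Lp.coeFn_add φ ψ] with x hx
      rw [hx, Pi.add_apply, mul_add]
    show ∫ x, (g x : ℂ) * (p.2 + q.2) x = _ * ∫ x, _ * (p.1 + q.1) x
    rw [key g hg.continuous hs, key _ (continuous_partial j hg) (hasCompactSupport_partial j hs),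
      hp g hg hs, hq g hg hs, mul_add]
  smul_mem' := by
    intro c p hp g hg hs
    have key : ∀ (f : Config m → ℝ) (φ : ModeSpace m), ∫ x, (f x : ℂ) * (c • φ) x =
          c * ∫ x, (f x : ℂ) * φ x := by
      intro f φ
      rw [← integral_const_mul]
      refine integral_congr_ae ?_
      filter_upwards [Lp.coeFn_smul c φ] with x hx
      rw [hx, Pi.smul_apply, smul_eq_mul]
      ring
    show ∫ x, (g x : ℂ) * (c • p.2) x = _ * ∫ x, _ * (c • p.1) x
    rw [key g, key, hp g hg hs]
    ring

/-- The graph of the quadrature `Q_k`: `X_j` for `k = (j, 0)` and `P_j` for `k = (j, 1)`. -/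
def quadratureGraph {m : ℕ} (k : Fin m × Fin 2) : Submodule ℂ (ModeSpace m × ModeSpace m) :=
  if k.2 = 0 then positionGraph k.1 else momentumGraph k.1

/-- The quadrature graphs are single-valued. -/
theorem quadratureGraph_singleValued {m : ℕ} (k : Fin m × Fin 2)
    (p : ModeSpace m × ModeSpace m) (hp : p ∈ quadratureGraph k) (h0 : p.1 = 0) : p.2 = 0 := by
  have hz := Lp.coeFn_zero ℂ 2 (volume : Measure (Config m))
  unfold quadratureGraph at hp
  split_ifs at hp
  · have hp' : ∀ᵐ x : Config m, p.2 x = (x k.1 : ℂ) * p.1 x := hp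
    rw [h0] at hp'
    refine Lp.ext ?_
    filter_upwards [hp', hz] with x h1 h2
    rw [h1, h2]
    simp
  · have hint : LocallyIntegrable (fun x : Config m => p.2 x) volume :=
      (Lp.memLp p.2).locallyIntegrable (by norm_num)
    have h : ∀ᵐ x : Config m, p.2 x = 0 := by
      refine ae_eq_zero_of_integral_contDiff_smul_eq_zero hint ?_
      intro g hg hs
      have h1 := hp g hg hs
      have h2 : ∫ x, (fderiv ℝ g x (EuclideanSpace.single k.1 1) : ℂ) * p.1 x = 0 := by
        refine integral_eq_zero_of_ae ?_
        rw [h0]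
        filter_upwards [hz] with x hx
        rw [hx, Pi.zero_apply, mul_zero]
      rw [h2, mul_zero] at h1
      simpa [Complex.real_smul] using h1
    refine Lp.ext ?_
    filter_upwards [h, hz] with x h1 h2
    rw [h1, h2]
    rfl

/-- The quadrature operators `Q = (X_1, P_1, …, X_m, P_m)` as unbounded operators. -/
def quadrature {m : ℕ} (k : Fin m × Fin 2) : ModeSpace m →ₗ.[ℂ] ModeSpace m :=
  (quadratureGraph k).toLinearPMap

open Classical in
/-- `Q_k ψ`, with the value `0` outside the domain of `Q_k`. -/
def applyQuadrature {m : ℕ} (k : Fin m × Fin 2) (ψ : ModeSpace m) : ModeSpace m :=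
  if h : ψ ∈ (quadrature k).domain then quadrature k ⟨ψ, h⟩ else 0

/-! ### Displacement operators -/

/-- Multiplication by a continuous function of modulus one, as an isometry of `L²`. -/
def phaseMul {m : ℕ} (u : Config m → ℂ) (hu : Continuous u) (h1 : ∀ x, ‖u x‖ = 1) :
    ModeSpace m →ₗᵢ[ℂ] ModeSpace m :=
  have hmem : ∀ ψ : ModeSpace m, MemLp (fun x => u x * ψ x) 2 (volume : Measure (Config m)) :=
    fun ψ => (Lp.memLp ψ).of_le (hu.aestronglyMeasurable.mul (Lp.aestronglyMeasurable ψ))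
      (Filter.Eventually.of_forall fun x => by rw [norm_mul, h1, one_mul])
  { toFun := fun ψ => (hmem ψ).toLp _
    map_add' := by
      intro φ ψ
      refine Lp.ext ?_
      filter_upwards [(hmem (φ + ψ)).coeFn_toLp, (hmem φ).coeFn_toLp, (hmem ψ).coeFn_toLp,
        Lp.coeFn_add φ ψ, Lp.coeFn_add ((hmem φ).toLp _) ((hmem ψ).toLp _)] with x a b c d e
      rw [a, e, Pi.add_apply, b, c, d, Pi.add_apply, mul_add]
    map_smul' := by
      intro z ψ
      refine Lp.ext ?_
      filter_upwards [(hmem (z • ψ)).coeFn_toLp, (hmem ψ).coeFn_toLp,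
        Lp.coeFn_smul z ψ, Lp.coeFn_smul z ((hmem ψ).toLp _)] with x a b c d
      rw [a, RingHom.id_apply, d, Pi.smul_apply, b, c, Pi.smul_apply, smul_eq_mul, smul_eq_mul]
      ring
    norm_map' := by
      intro ψ
      show ‖(hmem ψ).toLp _‖ = ‖ψ‖
      rw [Lp.norm_toLp, Lp.norm_def]
      congr 1
      refine eLpNorm_congr_norm_ae (Filter.Eventually.of_forall fun x => ?_)
      rw [norm_mul, h1, one_mul] }

/-- The position coordinates `a` of the phase space point `r = (a_1, b_1, …, a_m, b_m)`. -/
def positionPart {m : ℕ} (r : PhaseSpace m) : Config m := WithLp.toLp 2 fun j => r (j, 0)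

/-- The momentum coordinates `b` of the phase space point `r = (a_1, b_1, …, a_m, b_m)`. -/
def momentumPart {m : ℕ} (r : PhaseSpace m) : Config m := WithLp.toLp 2 fun j => r (j, 1)

/-- The phase `exp(i (a ⬝ x + a ⬝ b / 2))`. -/
def weylPhase {m : ℕ} (r : PhaseSpace m) (x : Config m) : ℂ :=
  Complex.exp (((⟪positionPart r, x⟫_ℝ + ⟪positionPart r, momentumPart r⟫_ℝ / 2 : ℝ) : ℂ)
    * Complex.I)

theorem continuous_weylPhase {m : ℕ} (r : PhaseSpace m) : Continuous (weylPhase r) := by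
  unfold weylPhase
  fun_prop

theorem norm_weylPhase {m : ℕ} (r : PhaseSpace m) (x : Config m) : ‖weylPhase r x‖ = 1 :=
  Complex.norm_exp_ofReal_mul_I _

/-- The displacement (Weyl) operator `D_r = exp(i r ⬝ Q) = exp(i ∑_j (a_j X_j + b_j P_j))` for
`r = (a_1, b_1, …, a_m, b_m)`. Since `[X_j, P_k] = i δ_{jk}`, the exponential acts by
`(D_r ψ)(x) = exp(i (a ⬝ x + a ⬝ b / 2)) ψ(x + b)`. -/
def displacement {m : ℕ} (r : PhaseSpace m) : ModeSpace m →L[ℂ] ModeSpace m :=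
  ((phaseMul (weylPhase r) (continuous_weylPhase r) (norm_weylPhase r)).comp
    (Lp.compMeasurePreservingₗᵢ ℂ (fun x : Config m => x + momentumPart r)
      (measurePreserving_add_right volume (momentumPart r)))).toContinuousLinearMap

/-- The formula for the displacement operator. -/
theorem displacement_apply_ae {m : ℕ} (r : PhaseSpace m) (ψ : ModeSpace m) :
    ∀ᵐ x : Config m, displacement r ψ x = weylPhase r x * ψ (x + momentumPart r) := by
  have hp := measurePreserving_add_right (volume : Measure (Config m)) (momentumPart r)
  have h2 := Lp.coeFn_compMeasurePreserving ψ hp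
  have h1 := MemLp.coeFn_toLp (μ := (volume : Measure (Config m))) (p := 2)
    (f := fun x => weylPhase r x * (Lp.compMeasurePreserving _ hp ψ) x)
    ((Lp.memLp (Lp.compMeasurePreserving _ hp ψ)).of_le
      ((continuous_weylPhase r).aestronglyMeasurable.mul (Lp.aestronglyMeasurable _))
      (Filter.Eventually.of_forall fun x => by rw [norm_mul, norm_weylPhase, one_mul]))
  filter_upwards [h1, h2] with x a b
  refine Eq.trans a ?_
  rw [b]
  rfl

/-! ### Trace, characteristic function and moments -/

/-- An index set of an orthonormal basis of the Hilbert space of `m` modes. -/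
def basisIndex (m : ℕ) : Set (ModeSpace m) :=
  Classical.choose (exists_hilbertBasis ℂ (ModeSpace m))

/-- A fixed orthonormal basis of the Hilbert space of `m` modes. It serves to write down traces of
trace class operators, which do not depend on the basis. -/
def stdBasis (m : ℕ) : HilbertBasis (basisIndex m) ℂ (ModeSpace m) :=
  Classical.choose (Classical.choose_spec (exists_hilbertBasis ℂ (ModeSpace m)))

/-- The trace `tr T = ∑_i ⟨e_i, T e_i⟩` of a trace class operator. -/
def trace {m : ℕ} (T : ModeSpace m →L[ℂ] ModeSpace m) : ℂ :=
  ∑' i, ⟪stdBasis m i, T (stdBasis m i)⟫_ℂ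

/-- `τ` is a Hermitian positive trace class operator of unit trace. (For a positive operator,
convergence of the sum of the diagonal entries in one orthonormal basis is the trace class
property.) -/
def IsState {m : ℕ} (τ : ModeSpace m →L[ℂ] ModeSpace m) : Prop :=
  τ.IsPositive ∧ HasSum (fun i => ⟪stdBasis m i, τ (stdBasis m i)⟫_ℂ) 1

/-- The characteristic function `χ_τ(r) = tr(D_r τ)`. -/
def charFn {m : ℕ} (τ : ModeSpace m →L[ℂ] ModeSpace m) (r : PhaseSpace m) : ℂ :=
  trace (displacement r ∘L τ)

/-- The positive square root `√T` of a positive bounded operator on a Hilbert space. -/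
def opSqrt {H : Type*} [NormedAddCommGroup H] [InnerProductSpace ℂ H] [CompleteSpace H]
    (T : H →L[ℂ] H) : H →L[ℂ] H :=
  CFC.sqrt T

theorem opSqrt_isPositive {H : Type*} [NormedAddCommGroup H] [InnerProductSpace ℂ H]
    [CompleteSpace H] (T : H →L[ℂ] H) : (opSqrt T).IsPositive :=
  (ContinuousLinearMap.nonneg_iff_isPositive _).1 (CFC.sqrt_nonneg T)

theorem opSqrt_comp_self {H : Type*} [NormedAddCommGroup H] [InnerProductSpace ℂ H]
    [CompleteSpace H] {T : H →L[ℂ] H} (hT : T.IsPositive) : opSqrt T ∘L opSqrt T = T :=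
  CFC.sqrt_mul_sqrt_self T ((ContinuousLinearMap.nonneg_iff_isPositive _).2 hT)

/-- `τ` has finite second moments: every `Q_k √τ` is an everywhere defined Hilbert–Schmidt
operator, i.e. `tr(√τ Q_k² √τ) < ∞`. -/
def HasFiniteSecondMoments {m : ℕ} (τ : ModeSpace m →L[ℂ] ModeSpace m) : Prop :=
  ∀ k : Fin m × Fin 2, (∀ ψ, opSqrt τ ψ ∈ (quadrature k).domain) ∧
    Summable fun i => ‖applyQuadrature k (opSqrt τ (stdBasis m i))‖ ^ 2

/-- The first moments `d_k = tr(Q_k τ) = tr(√τ Q_k √τ) = ∑_i ⟨√τ e_i, Q_k √τ e_i⟩`, which are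
real numbers because `Q_k` is symmetric. -/
def firstMoment {m : ℕ} (τ : ModeSpace m →L[ℂ] ModeSpace m) (k : Fin m × Fin 2) : ℝ :=
  (∑' i, ⟪opSqrt τ (stdBasis m i), applyQuadrature k (opSqrt τ (stdBasis m i))⟫_ℂ).re

/-- `(Q_k - d_k) √τ ψ`, where `d_k` is the first moment. -/
def centeredQuadrature {m : ℕ} (τ : ModeSpace m →L[ℂ] ModeSpace m) (k : Fin m × Fin 2)
    (ψ : ModeSpace m) : ModeSpace m :=
  applyQuadrature k (opSqrt τ ψ) - (firstMoment τ k : ℂ) • opSqrt τ ψ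

/-- The covariance matrix `Γ_{jk} = 2 Re tr[(Q_j - d_j)(Q_k - d_k) τ]`; the trace is written as
`tr[√τ (Q_j - d_j)(Q_k - d_k) √τ] = ∑_i ⟨(Q_j - d_j) √τ e_i, (Q_k - d_k) √τ e_i⟩`, which makes
sense as soon as `τ` has finite second moments. -/
def covarianceMatrix {m : ℕ} (τ : ModeSpace m →L[ℂ] ModeSpace m) :
    Matrix (Fin m × Fin 2) (Fin m × Fin 2) ℝ :=
  fun j k => 2 * (∑' i, ⟪centeredQuadrature τ j (stdBasis m i),
    centeredQuadrature τ k (stdBasis m i)⟫_ℂ).re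

/-- The Gaussian characteristic function `exp(i r ⬝ d - rᵀ Γ r / 4)` with first moments `d` and
covariance matrix `Γ`. -/
def gaussianCharFn {m : ℕ} (d : PhaseSpace m) (Γ : Matrix (Fin m × Fin 2) (Fin m × Fin 2) ℝ)
    (r : PhaseSpace m) : ℂ :=
  Complex.exp (Complex.I * ((∑ k, r k * d k : ℝ) : ℂ) -
    ((∑ j, ∑ k, r j * Γ j k * r k : ℝ) : ℂ) / 4)

/-- A central limit sequence `τ_1, τ_2, …` (the entry with index `0` is irrelevant): unit trace
Hermitian positive operators with `χ_{τ_N}(r) = χ_{τ_1}(r / √N) ^ N`, where `τ_1` has finite second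
moments and zero first moments. -/
structure IsCentralLimitSequence {m : ℕ} (τ : ℕ → (ModeSpace m →L[ℂ] ModeSpace m)) : Prop where
  isState : ∀ N, 1 ≤ N → IsState (τ N)
  charFn_eq : ∀ N, 1 ≤ N → ∀ r : PhaseSpace m,
    charFn (τ N) r = charFn (τ 1) ((Real.sqrt N)⁻¹ • r) ^ N
  finiteSecondMoments : HasFiniteSecondMoments (τ 1)
  firstMoment_eq_zero : ∀ k, firstMoment (τ 1) k = 0

end

end QuantumCLT

/-!
The proof works with the vectors `ψ_i = √τ₁ e_i`, which lie in the domains of all quadratures.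
By cyclicity of the trace for Hilbert–Schmidt operators (`tsum_inner_comp_eq`),
`χ(r) = tr(D_r τ₁) = ∑_i ⟨ψ_i, D_r ψ_i⟩ = ⟨Φ 0, Φ r⟩`, where `Φ r = (D_r ψ_i)_i` is a curve in the
Hilbert sum of copies of `L²(ℝᵐ)`; this sum stands in for the space of Hilbert–Schmidt operators
and `Φ r` for `D_r √τ₁`.

On the domain of all quadratures, `D_r ψ = ψ + i r ⬝ Q ψ + o(|r|)` (`displacement_sub_isLittleO`).
Up to a scalar phase `D_r` is a plane wave after a translation. For the plane wave the expansion is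
dominated convergence; for the translation it follows from `T_b ψ - ψ = i ∫₀¹ T_{tb} (b ⬝ P ψ) dt`,
which is checked against test functions (`IsWeakMomentum.translation_sub_eq`), and from strong
continuity of translations. A Lipschitz bound whose constants are square-summable over `i` turns
this into a first order expansion of `Φ` with derivative `i A r`, where `A r = (r ⬝ Q ψ_i)_i`.

Differentiability of `Φ` at the origin is enough for a second order expansion of `⟨Φ 0, Φ r⟩`
(`inner_sub_isLittleO_sq`), because the `D_r` are unitary and form a group on every line. The real
part is `|Φ 0|² - |Φ r - Φ 0|² / 2 = 1 - |A r|² / 2 + o(|r|²)`. The imaginary part `h` satisfies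
`h(2r) = 2 h(r) + o(|r|²)`, as `⟨Φ 0, Φ (2r)⟩ = ⟨Φ (-r), Φ r⟩`, and is `o(|r|)` since the first
moments vanish; summing over dyadic scales gives `h = o(|r|²)`. As `2 |A r|² = rᵀ Γ r`, the
function `χ` agrees with the Gaussian characteristic function up to `o(|r|²)`
(`charFn_sub_gaussianCharFn_isLittleO`).

Both functions are bounded by `1`, so `|z ^ N - w ^ N| ≤ N |z - w|` at the point `r / √N` bounds the
distance of their `N`-th powers by `N o(|r|² / N)`, uniformly for bounded `r`, and the Gaussian is
stable under `w(r / √N) ^ N = w(r)`.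
-/

namespace QuantumCLT

open MeasureTheory Filter Topology Asymptotics
open scoped ContDiff InnerProductSpace

noncomputable section

/-! ### Translations -/

/-- The translation `(T_b ψ)(x) = ψ(x + b)` on `L²`. -/
def translation {m : ℕ} (b : Config m) : ModeSpace m →ₗᵢ[ℂ] ModeSpace m :=
  Lp.compMeasurePreservingₗᵢ ℂ (fun x : Config m => x + b) (measurePreserving_add_right volume b)

theorem translation_apply_ae {m : ℕ} (b : Config m) (ψ : ModeSpace m) :
    ∀ᵐ x : Config m, translation b ψ x = ψ (x + b) :=
  Lp.coeFn_compMeasurePreserving ψ (measurePreserving_add_right volume b)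

theorem translation_zero {m : ℕ} (ψ : ModeSpace m) : translation 0 ψ = ψ := by
  refine Lp.ext ?_
  filter_upwards [translation_apply_ae 0 ψ] with x hx
  rw [hx, add_zero]

theorem continuous_translation {m : ℕ} (ψ : ModeSpace m) :
    Continuous fun b : Config m => translation b ψ := by
  let g : Config m → C(Config m, Config m) := fun b => ⟨fun x => x + b, by fun_prop⟩
  have hg : Continuous g :=
    ContinuousMap.continuous_of_continuous_uncurry _ (by
      show Continuous fun p : Config m × Config m => p.2 + p.1
      fun_prop)
  exact Continuous.compMeasurePreservingLp (p := 2) continuous_const hg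
    (fun b => measurePreserving_add_right volume b) (by norm_num)

/-- Integration against a real test function, as a continuous linear functional on `L²`. -/
theorem exists_testFunctional {m : ℕ} {g : Config m → ℝ} (hg : Continuous g)
    (hs : HasCompactSupport g) :
    ∃ l : ModeSpace m →L[ℂ] ℂ, ∀ ψ, l ψ = ∫ x, (g x : ℂ) * ψ x := by
  have hmem : MemLp (fun x => (g x : ℂ)) 2 (volume : Measure (Config m)) :=
    (Complex.continuous_ofReal.comp hg).memLp_of_hasCompactSupport
      (hs.comp_left (g := fun t : ℝ => (t : ℂ)) Complex.ofReal_zero)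
  refine ⟨innerSL ℂ (hmem.toLp _), fun ψ => ?_⟩
  rw [innerSL_apply_apply, L2.inner_def]
  refine integral_congr_ae ?_
  filter_upwards [hmem.coeFn_toLp] with x hx
  rw [hx, RCLike.inner_apply, mul_comm]
  simp

theorem integral_mul_translation {m : ℕ} (g : Config m → ℝ) (b : Config m) (ψ : ModeSpace m) :
    ∫ x, (g x : ℂ) * translation b ψ x = ∫ x, (g (x - b) : ℂ) * ψ x := by
  rw [← integral_add_right_eq_self (fun x => (g (x - b) : ℂ) * ψ x) b]
  refine integral_congr_ae ?_
  filter_upwards [translation_apply_ae b ψ] with x hx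
  rw [hx, add_sub_cancel_right]

/-- The relation `p = -i ∂_b ψ` in the weak sense, tested against real test functions. -/
def IsWeakMomentum {m : ℕ} (b : Config m) (ψ p : ModeSpace m) : Prop :=
  ∀ g : Config m → ℝ, ContDiff ℝ ∞ g → HasCompactSupport g →
    ∫ x, (g x : ℂ) * p x = Complex.I * ∫ x, (fderiv ℝ g x b : ℂ) * ψ x

/-- Moving the translation to the test function turns the pairing into a convolution with a
smooth function, which may be differentiated under the integral sign. -/
theorem IsWeakMomentum.hasDerivAt_integral_translation {m : ℕ} {b : Config m} {ψ p : ModeSpace m}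
    (h : IsWeakMomentum b ψ p) {g : Config m → ℝ} (hg : ContDiff ℝ ∞ g)
    (hs : HasCompactSupport g) (t : ℝ) :
    HasDerivAt (fun t : ℝ => ∫ x, (g x : ℂ) * translation (t • b) ψ x)
      (Complex.I * ∫ x, (g x : ℂ) * translation (t • b) p x) t := by
  -- The pairing at `t` is the convolution of `ψ` with the reflected test function, at `t • b`.
  have hneg : ContDiff ℝ ∞ (fun x : Config m => g (-x)) := hg.comp contDiff_neg
  have hsneg : HasCompactSupport (fun x : Config m => g (-x)) :=
    hs.comp_homeomorph (Homeomorph.neg (Config m))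
  have hint : LocallyIntegrable (fun x : Config m => ψ x) volume :=
    (Lp.memLp ψ).locallyIntegrable (by norm_num)
  have hd := hsneg.hasFDerivAt_convolution_right
    (ContinuousLinearMap.lsmul ℝ ℝ (E := ℂ)).flip hint (hneg.of_le (by simp)) (t • b)
  have hline : HasDerivAt (fun t : ℝ => t • b) b t := by
    simpa using (hasDerivAt_id t).smul_const b
  have hcomp := hd.comp_hasDerivAt t hline
  rw [convolution_precompR_apply _ hint (hsneg.fderiv (𝕜 := ℝ))
    (hneg.continuous_fderiv (by simp))] at hcomp
  refine (hcomp.congr_deriv ?_).congr_of_eventuallyEq (Eventually.of_forall fun s => ?_)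
  · have hshift : ContDiff ℝ ∞ (fun x : Config m => g (x - t • b)) :=
      hg.comp (contDiff_id.sub contDiff_const)
    have hsshift : HasCompactSupport (fun x : Config m => g (x - t • b)) := by
      simpa only [sub_eq_add_neg] using! hs.comp_homeomorph (Homeomorph.addRight (-(t • b)))
    rw [integral_mul_translation, h _ hshift hsshift, ← mul_assoc, Complex.I_mul_I, neg_one_mul,
      ← integral_neg]
    refine integral_congr_ae (Eventually.of_forall fun x => ?_)
    have h1 : fderiv ℝ (fun x : Config m => g (-x)) (t • b - x) b = -fderiv ℝ g (x - t • b) b := by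
      have hd := ((hg.differentiable (by simp)).differentiableAt (x := -(t • b - x))).hasFDerivAt
      have hn := hd.comp (t • b - x) (hasFDerivAt_id (t • b - x)).neg
      rw [show (fun x : Config m => g (-x)) = g ∘ Neg.neg from rfl, hn.fderiv, neg_sub]
      simp
    have h2 : fderiv ℝ (fun x : Config m => g (x - t • b)) x b = fderiv ℝ g (x - t • b) b := by
      rw [fderiv_comp_sub]
    simp only [ContinuousLinearMap.flip_apply, ContinuousLinearMap.lsmul_apply, h1, h2,
      Complex.real_smul]
    push_cast
    ring
  · refine (integral_mul_translation g (s • b) ψ).trans ?_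
    refine integral_congr_ae (Eventually.of_forall fun x => ?_)
    simp [Complex.real_smul]

/-- The fundamental theorem of calculus for translations: `T_b ψ - ψ = i ∫₀¹ T_{tb} p dt` when
`p = -i ∂_b ψ` weakly. -/
theorem IsWeakMomentum.translation_sub_eq {m : ℕ} {b : Config m} {ψ p : ModeSpace m}
    (h : IsWeakMomentum b ψ p) :
    translation b ψ - ψ = Complex.I • ∫ t in (0 : ℝ)..1, translation (t • b) p := by
  have hcont : Continuous fun t : ℝ => translation (t • b) p :=
    (continuous_translation p).comp (continuous_id.smul continuous_const)
  have hint : IntervalIntegrable (fun t : ℝ => translation (t • b) p) volume 0 1 :=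
    hcont.intervalIntegrable 0 1
  rw [← sub_eq_zero]
  set w := translation b ψ - ψ - Complex.I • ∫ t in (0 : ℝ)..1, translation (t • b) p with hw
  have hloc : LocallyIntegrable (fun x : Config m => w x) volume :=
    (Lp.memLp w).locallyIntegrable (by norm_num)
  have h0 : ∀ᵐ x : Config m, w x = 0 := by
    refine ae_eq_zero_of_integral_contDiff_smul_eq_zero hloc fun g hg hs => ?_
    obtain ⟨l, hl⟩ := exists_testFunctional hg.continuous hs
    have hftc := intervalIntegral.integral_eq_sub_of_hasDerivAt (a := 0) (b := 1)
      (fun t _ => h.hasDerivAt_integral_translation hg hs t)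
      (by
        simp_rw [← hl]
        exact ((l.continuous.comp hcont).const_smul Complex.I).intervalIntegrable 0 1)
    simp_rw [← hl, zero_smul, one_smul, translation_zero] at hftc
    rw [intervalIntegral.integral_const_mul, l.intervalIntegral_comp_comm hint] at hftc
    simp_rw [Complex.real_smul]
    rw [← hl, hw, map_sub, map_sub, map_smul, smul_eq_mul, hftc, sub_self]
  refine Lp.ext ?_
  filter_upwards [h0, Lp.coeFn_zero ℂ 2 (volume : Measure (Config m))] with x h1 h2
  rw [h1, h2, Pi.zero_apply]

theorem IsWeakMomentum.norm_translation_sub_le {m : ℕ} {b : Config m} {ψ p : ModeSpace m}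
    (h : IsWeakMomentum b ψ p) : ‖translation b ψ - ψ‖ ≤ ‖p‖ := by
  rw [h.translation_sub_eq, norm_smul, Complex.norm_I, one_mul]
  simpa using intervalIntegral.norm_integral_le_of_norm_le_const (a := 0) (b := 1)
    (f := fun t : ℝ => translation (t • b) p) (C := ‖p‖)
    (fun t _ => (LinearIsometry.norm_map _ p).le)

theorem IsWeakMomentum.norm_translation_sub_sub_le {m : ℕ} {b : Config m} {ψ p : ModeSpace m}
    (h : IsWeakMomentum b ψ p) {C : ℝ}
    (hC : ∀ t ∈ Set.Icc (0 : ℝ) 1, ‖translation (t • b) p - p‖ ≤ C) :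
    ‖translation b ψ - ψ - Complex.I • p‖ ≤ C := by
  have hcont : Continuous fun t : ℝ => translation (t • b) p :=
    (continuous_translation p).comp (continuous_id.smul continuous_const)
  have hp : p = ∫ _ in (0 : ℝ)..1, p := by simp
  rw [h.translation_sub_eq]
  nth_rw 2 [hp]
  rw [← smul_sub, ← intervalIntegral.integral_sub (hcont.intervalIntegrable 0 1)
    (intervalIntegrable_const), norm_smul, Complex.norm_I, one_mul]
  simpa using intervalIntegral.norm_integral_le_of_norm_le_const (a := 0) (b := 1)
    (f := fun t : ℝ => translation (t • b) p - p) (C := C)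
    (fun t ht => by
      rw [Set.uIoc_of_le zero_le_one] at ht
      exact hC t ⟨ht.1.le, ht.2⟩)

/-- Weak momenta along the coordinate axes combine linearly to a weak momentum along `b`. -/
theorem isWeakMomentum_sum {m : ℕ} {ψ : ModeSpace m} {p : Fin m → ModeSpace m}
    (hp : ∀ j, (ψ, p j) ∈ momentumGraph j) (b : Config m) :
    IsWeakMomentum b ψ (∑ j, (b j : ℂ) • p j) := by
  intro g hg hs
  obtain ⟨l, hl⟩ := exists_testFunctional hg.continuous hs
  rw [← hl, map_sum]
  have hb : b = ∑ j, b j • EuclideanSpace.single j (1 : ℝ) := by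
    ext i
    simp [Finset.sum_apply, Pi.single_apply]
  have h1 : ∀ x, (fderiv ℝ g x b : ℂ) * ψ x =
      ∑ j, (b j : ℂ) * ((fderiv ℝ g x (EuclideanSpace.single j 1) : ℂ) * ψ x) := by
    intro x
    conv_lhs => rw [hb]
    simp only [map_sum, map_smul, smul_eq_mul, Complex.ofReal_sum, Complex.ofReal_mul,
      Finset.sum_mul, mul_assoc]
  simp_rw [h1]
  rw [integral_finsetSum _ fun j _ => (integrable_test_mul _ (continuous_partial j hg)
    (hasCompactSupport_partial j hs) ψ).const_mul _, Finset.mul_sum]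
  refine Finset.sum_congr rfl fun j _ => ?_
  rw [map_smul, hl, smul_eq_mul, integral_const_mul, hp j g hg hs]
  ring

theorem translation_sub_isLittleO {m : ℕ} {ψ : ModeSpace m} {p : Fin m → ModeSpace m}
    (hp : ∀ j, (ψ, p j) ∈ momentumGraph j) :
    (fun b : Config m => translation b ψ - ψ - Complex.I • ∑ j, (b j : ℂ) • p j)
      =o[𝓝 0] fun b => b := by
  rw [isLittleO_iff]
  intro c hc
  obtain ⟨c', hc', hcc⟩ : ∃ c' > 0, m * c' ≤ c :=
    ⟨c / (m + 1), by positivity, by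
      rw [mul_div_assoc', div_le_iff₀ (by positivity)]
      nlinarith⟩
  have hev : ∀ᶠ b : Config m in 𝓝 0, ∀ j, ‖translation b (p j) - p j‖ < c' := by
    refine eventually_all.2 fun j => ?_
    have ht : Tendsto (fun b : Config m => ‖translation b (p j) - p j‖) (𝓝 0) (𝓝 0) := by
      have := ((continuous_translation (p j)).sub continuous_const).norm.tendsto
        (f := fun b : Config m => ‖translation b (p j) - p j‖) 0
      simpa [translation_zero] using this
    exact ht.eventually_lt_const hc'
  obtain ⟨δ, hδ, hball⟩ := Metric.eventually_nhds_iff_ball.1 hev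
  filter_upwards [Metric.ball_mem_nhds 0 hδ] with b hb
  refine (isWeakMomentum_sum hp b).norm_translation_sub_sub_le fun t ht => ?_
  have htb : t • b ∈ Metric.ball (0 : Config m) δ := by
    rw [mem_ball_zero_iff] at hb ⊢
    rw [norm_smul, Real.norm_of_nonneg ht.1]
    exact (mul_le_of_le_one_left (norm_nonneg _) ht.2).trans_lt hb
  have hj := hball _ htb
  calc ‖translation (t • b) (∑ j, (b j : ℂ) • p j) - ∑ j, (b j : ℂ) • p j‖
      = ‖∑ j, (b j : ℂ) • (translation (t • b) (p j) - p j)‖ := by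
        simp only [map_sum, map_smul, smul_sub, Finset.sum_sub_distrib]
    _ ≤ ∑ _j : Fin m, ‖b‖ * c' := by
        refine (norm_sum_le _ _).trans (Finset.sum_le_sum fun j _ => ?_)
        rw [norm_smul, Complex.norm_real]
        exact mul_le_mul (PiLp.norm_apply_le b j) (hj j).le (norm_nonneg _) (norm_nonneg _)
    _ = (m * c') * ‖b‖ := by simp; ring
    _ ≤ c * ‖b‖ := by gcongr

/-! ### Multiplication by plane waves -/

theorem norm_exp_mul_I_sub_one_le_abs (s : ℝ) : ‖Complex.exp (s * Complex.I) - 1‖ ≤ |s| := by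
  have := Real.norm_exp_I_mul_ofReal_sub_one_le (x := s)
  rwa [mul_comm, Real.norm_eq_abs] at this

theorem norm_exp_mul_I_sub_one_le_min (s : ℝ) :
    ‖Complex.exp (s * Complex.I) - 1‖ ≤ min 2 (2 * |s|) := by
  refine le_min ?_ ?_
  · refine (norm_sub_le _ _).trans ?_
    rw [Complex.norm_exp_ofReal_mul_I, norm_one]
    norm_num
  · linarith [norm_exp_mul_I_sub_one_le_abs s, abs_nonneg s]

theorem norm_exp_mul_I_sub_one_sub_le (s : ℝ) :
    ‖Complex.exp (s * Complex.I) - 1 - s * Complex.I‖ ≤ min 2 (2 * |s|) * |s| := by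
  have hs : ‖(s : ℂ) * Complex.I‖ = |s| := by simp
  rcases le_or_gt |s| 1 with h | h
  · rw [min_eq_right (by linarith)]
    have := Complex.norm_exp_sub_one_sub_id_le (x := s * Complex.I) (by rwa [hs])
    rw [hs] at this
    nlinarith [abs_nonneg s]
  · rw [min_eq_left (by linarith)]
    calc _ ≤ ‖Complex.exp (s * Complex.I) - 1‖ + ‖(s : ℂ) * Complex.I‖ := norm_sub_le _ _
      _ ≤ 2 * |s| := by rw [hs]; linarith [norm_exp_mul_I_sub_one_le_abs s]

theorem norm_sq_eq_integral {m : ℕ} (ψ : ModeSpace m) : ‖ψ‖ ^ 2 = ∫ x, ‖ψ x‖ ^ 2 := by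
  have h := inner_self_eq_norm_sq_to_K (𝕜 := ℂ) ψ
  rw [L2.inner_def] at h
  have h2 : ∀ x, ⟪ψ x, ψ x⟫_ℂ = ((‖ψ x‖ ^ 2 : ℝ) : ℂ) := fun x => by
    rw [inner_self_eq_norm_sq_to_K]
    norm_cast
  simp_rw [h2] at h
  rw [integral_complex_ofReal] at h
  have h3 : ((∫ x, ‖ψ x‖ ^ 2 : ℝ) : ℂ) = ((‖ψ‖ ^ 2 : ℝ) : ℂ) := by
    rw [h]
    norm_cast
  exact (Complex.ofReal_injective h3).symm

/-- Dominated convergence in `L²` as `a → 0`. The multiplier `min 2 (2 |a ⬝ x|)` dominates both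
`|e^{is} - 1|` and `|e^{is} - 1 - is| / |s|` at `s = a ⬝ x`. -/
theorem tendsto_norm_zero_of_le_min_inner_mul {m : ℕ} {φ : Config m → ℝ} (hφ : MemLp φ 2 volume)
    {Φ : Config m → ModeSpace m}
    (hΦ : ∀ a, ∀ᵐ x, ‖Φ a x‖ ≤ min 2 (2 * |⟪a, x⟫_ℝ|) * φ x) :
    Tendsto (fun a => ‖Φ a‖) (𝓝 0) (𝓝 0) := by
  have hφm := hφ.aestronglyMeasurable
  have hint : Integrable (fun x => 4 * φ x ^ 2) volume := by
    simpa using (hφ.integrable_norm_pow (p := 2) (by norm_num)).const_mul 4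
  have hκ0 : ∀ a x : Config m, 0 ≤ min 2 (2 * |⟪a, x⟫_ℝ|) := fun a x => by positivity
  have hmeas : ∀ a : Config m,
      AEStronglyMeasurable (fun x => (min 2 (2 * |⟪a, x⟫_ℝ|) * φ x) ^ 2) volume := fun a => by
    have hc : Continuous fun x : Config m => min 2 (2 * |⟪a, x⟫_ℝ|) := by fun_prop
    exact (hc.aestronglyMeasurable.mul hφm).pow 2
  have hbound : ∀ a x : Config m, ‖(min 2 (2 * |⟪a, x⟫_ℝ|) * φ x) ^ 2‖ ≤ 4 * φ x ^ 2 := by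
    intro a x
    rw [Real.norm_of_nonneg (by positivity), mul_pow]
    have := pow_le_pow_left₀ (hκ0 a x) (min_le_left 2 (2 * |⟪a, x⟫_ℝ|)) 2
    gcongr
    linarith
  have key : Tendsto (fun a : Config m => ∫ x, (min 2 (2 * |⟪a, x⟫_ℝ|) * φ x) ^ 2) (𝓝 0)
      (𝓝 (∫ _ : Config m, (0 : ℝ))) := by
    refine tendsto_integral_filter_of_dominated_convergence (fun x => 4 * φ x ^ 2)
      (Eventually.of_forall hmeas)
      (Eventually.of_forall fun a => Eventually.of_forall (hbound a)) hint
      (Eventually.of_forall fun x => ?_)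
    have hc : Continuous fun a : Config m => (min 2 (2 * |⟪a, x⟫_ℝ|) * φ x) ^ 2 := by fun_prop
    simpa using hc.tendsto 0
  rw [integral_zero] at key
  have hsq : Tendsto (fun a => ‖Φ a‖ ^ 2) (𝓝 0) (𝓝 0) := by
    refine squeeze_zero (fun a => by positivity) (fun a => ?_) key
    rw [norm_sq_eq_integral]
    refine integral_mono_ae ((Lp.memLp (Φ a)).integrable_norm_pow (p := 2) (by norm_num))
      (hint.mono' (hmeas a) (Eventually.of_forall (hbound a))) ?_
    filter_upwards [hΦ a] with x hx
    exact pow_le_pow_left₀ (norm_nonneg _) hx 2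
  simpa using hsq.sqrt

/-- The multiplication `(M_a ψ)(x) = e^{i a ⬝ x} ψ(x)` by a plane wave on `L²`. -/
def boost {m : ℕ} (a : Config m) : ModeSpace m →ₗᵢ[ℂ] ModeSpace m :=
  phaseMul (fun x => Complex.exp ((⟪a, x⟫_ℝ : ℂ) * Complex.I)) (by fun_prop)
    (fun x => Complex.norm_exp_ofReal_mul_I _)

theorem boost_apply_ae {m : ℕ} (a : Config m) (ψ : ModeSpace m) :
    ∀ᵐ x : Config m, boost a ψ x = Complex.exp ((⟪a, x⟫_ℝ : ℂ) * Complex.I) * ψ x :=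
  MemLp.coeFn_toLp (μ := (volume : Measure (Config m))) (p := 2)
    ((Lp.memLp ψ).of_le (Continuous.aestronglyMeasurable (by fun_prop) |>.mul
      (Lp.aestronglyMeasurable ψ)) (Eventually.of_forall fun x => by
        rw [Pi.mul_apply, norm_mul, Complex.norm_exp_ofReal_mul_I, one_mul]))

theorem tendsto_boost_sub {m : ℕ} (φ : ModeSpace m) :
    Tendsto (fun a : Config m => boost a φ - φ) (𝓝 0) (𝓝 0) := by
  rw [tendsto_zero_iff_norm_tendsto_zero]
  refine tendsto_norm_zero_of_le_min_inner_mul (φ := fun x => ‖φ x‖) (Lp.memLp φ).norm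
    fun a => ?_
  filter_upwards [boost_apply_ae a φ, Lp.coeFn_sub (boost a φ) φ] with x h1 h2
  rw [h2, Pi.sub_apply, h1, ← sub_one_mul, norm_mul]
  gcongr
  exact norm_exp_mul_I_sub_one_le_min _

theorem sum_smul_position_apply_ae {m : ℕ} {ψ : ModeSpace m} {p : Fin m → ModeSpace m}
    (hp : ∀ j, (ψ, p j) ∈ positionGraph j) (a : Config m) :
    ∀ᵐ x : Config m, (∑ j, (a j : ℂ) • p j : ModeSpace m) x = (⟪a, x⟫_ℝ : ℂ) * ψ x := by
  have h1 : ∀ᵐ x : Config m, ∀ j, p j x = (x j : ℂ) * ψ x := ae_all_iff.2 hp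
  have h2 : ∀ᵐ x : Config m, ∀ j, ((a j : ℂ) • p j : ModeSpace m) x = (a j : ℂ) * p j x :=
    ae_all_iff.2 fun j => Lp.coeFn_smul _ _
  filter_upwards [h1, h2, Lp.coeFn_fun_finsetSum Finset.univ fun j => (a j : ℂ) • p j]
    with x h1 h2 h3
  rw [h3]
  simp_rw [h2, h1, PiLp.inner_apply, Complex.ofReal_sum, Finset.sum_mul]
  refine Finset.sum_congr rfl fun j _ => ?_
  simp
  ring

theorem norm_boost_sub_le {m : ℕ} {ψ : ModeSpace m} {p : Fin m → ModeSpace m}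
    (hp : ∀ j, (ψ, p j) ∈ positionGraph j) (a : Config m) :
    ‖boost a ψ - ψ‖ ≤ ‖∑ j, (a j : ℂ) • p j‖ := by
  refine Lp.norm_le_norm_of_ae_le ?_
  filter_upwards [boost_apply_ae a ψ, Lp.coeFn_sub (boost a ψ) ψ,
    sum_smul_position_apply_ae hp a] with x h1 h2 h3
  rw [h2, Pi.sub_apply, h1, ← sub_one_mul, h3, norm_mul, norm_mul, Complex.norm_real]
  gcongr
  exact norm_exp_mul_I_sub_one_le_abs _

theorem boost_sub_isLittleO {m : ℕ} {ψ : ModeSpace m} {p : Fin m → ModeSpace m}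
    (hp : ∀ j, (ψ, p j) ∈ positionGraph j) :
    (fun a : Config m => boost a ψ - ψ - Complex.I • ∑ j, (a j : ℂ) • p j)
      =o[𝓝 0] fun a => a := by
  -- After division by `‖a‖`, the remainder is dominated by a fixed `L²` function.
  have hlim : Tendsto (fun a : Config m =>
      ‖((‖a‖⁻¹ : ℝ) : ℂ) • (boost a ψ - ψ - Complex.I • ∑ j, (a j : ℂ) • p j)‖) (𝓝 0) (𝓝 0) := by
    refine tendsto_norm_zero_of_le_min_inner_mul (φ := fun x => ∑ j, ‖p j x‖)
      (memLp_finsetSum _ fun j _ => (Lp.memLp (p j)).norm) fun a => ?_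
    have h5 : ∀ᵐ x : Config m, ∀ j, p j x = (x j : ℂ) * ψ x := ae_all_iff.2 hp
    filter_upwards [boost_apply_ae a ψ, Lp.coeFn_sub (boost a ψ) ψ,
      sum_smul_position_apply_ae hp a,
      Lp.coeFn_sub (boost a ψ - ψ) (Complex.I • ∑ j, (a j : ℂ) • p j),
      Lp.coeFn_smul Complex.I (∑ j, (a j : ℂ) • p j), h5,
      Lp.coeFn_smul ((‖a‖⁻¹ : ℝ) : ℂ)
        (boost a ψ - ψ - Complex.I • ∑ j, (a j : ℂ) • p j)] with x h1 h2 h3 h4 h6 h5 h7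
    have hle : |⟪a, x⟫_ℝ| * ‖ψ x‖ ≤ ‖a‖ * ∑ j, ‖p j x‖ := by
      rw [PiLp.inner_apply, Finset.mul_sum]
      refine (mul_le_mul_of_nonneg_right (Finset.abs_sum_le_sum_abs _ _) (norm_nonneg _)).trans ?_
      rw [Finset.sum_mul]
      refine Finset.sum_le_sum fun j _ => ?_
      have hj := PiLp.norm_apply_le a j
      rw [Real.norm_eq_abs] at hj
      rw [h5 j, norm_mul, Complex.norm_real, Real.norm_eq_abs, RCLike.inner_apply, abs_mul,
        ← mul_assoc]
      simp only [conj_trivial]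
      rw [mul_comm |x j|]
      gcongr
    have heq : boost a ψ x - ψ x - Complex.I * ((⟪a, x⟫_ℝ : ℂ) * ψ x) =
        (Complex.exp ((⟪a, x⟫_ℝ : ℂ) * Complex.I) - 1 - (⟪a, x⟫_ℝ : ℂ) * Complex.I) * ψ x := by
      rw [h1]
      ring
    rw [h7, Pi.smul_apply, h4, Pi.sub_apply, h2, Pi.sub_apply, h6, Pi.smul_apply, h3, smul_eq_mul,
      smul_eq_mul, heq, norm_mul, norm_mul, Complex.norm_real, norm_inv, norm_norm]
    have hκ0 : 0 ≤ min 2 (2 * |⟪a, x⟫_ℝ|) := by positivity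
    calc ‖a‖⁻¹ * (_ * ‖ψ x‖)
        ≤ ‖a‖⁻¹ * ((min 2 (2 * |⟪a, x⟫_ℝ|) * |⟪a, x⟫_ℝ|) * ‖ψ x‖) := by
          gcongr
          exact norm_exp_mul_I_sub_one_sub_le _
      _ = min 2 (2 * |⟪a, x⟫_ℝ|) * (‖a‖⁻¹ * (|⟪a, x⟫_ℝ| * ‖ψ x‖)) := by ring
      _ ≤ min 2 (2 * |⟪a, x⟫_ℝ|) * (‖a‖⁻¹ * (‖a‖ * ∑ j, ‖p j x‖)) := by gcongr
      _ ≤ min 2 (2 * |⟪a, x⟫_ℝ|) * ∑ j, ‖p j x‖ := by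
          gcongr
          rw [← mul_assoc]
          exact mul_le_of_le_one_left (Finset.sum_nonneg fun j _ => norm_nonneg _)
            inv_mul_le_one
  rw [isLittleO_iff]
  intro c hc
  filter_upwards [hlim.eventually_lt_const hc] with a ha
  rcases eq_or_ne a 0 with rfl | ha0
  · have hz : boost 0 ψ = ψ := by
      refine Lp.ext ?_
      filter_upwards [boost_apply_ae 0 ψ] with x hx
      rw [hx]
      simp
    simp [hz]
  · have hpos : 0 < ‖a‖ := norm_pos_iff.2 ha0
    rw [norm_smul, Complex.norm_real, norm_inv, norm_norm, inv_mul_lt_iff₀ hpos] at ha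
    rw [mul_comm]
    exact ha.le

/-! ### Displacement operators -/

theorem norm_positionPart_le {m : ℕ} (r : PhaseSpace m) : ‖positionPart r‖ ≤ ‖r‖ := by
  rw [EuclideanSpace.norm_eq, EuclideanSpace.norm_eq]
  refine Real.sqrt_le_sqrt ?_
  rw [Fintype.sum_prod_type]
  refine Finset.sum_le_sum fun j _ => ?_
  rw [Fin.sum_univ_two]
  exact le_add_of_nonneg_right (by positivity)

theorem norm_momentumPart_le {m : ℕ} (r : PhaseSpace m) : ‖momentumPart r‖ ≤ ‖r‖ := by
  rw [EuclideanSpace.norm_eq, EuclideanSpace.norm_eq]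
  refine Real.sqrt_le_sqrt ?_
  rw [Fintype.sum_prod_type]
  refine Finset.sum_le_sum fun j _ => ?_
  rw [Fin.sum_univ_two]
  exact le_add_of_nonneg_left (by positivity)

theorem norm_displacement {m : ℕ} (r : PhaseSpace m) (ψ : ModeSpace m) :
    ‖displacement r ψ‖ = ‖ψ‖ :=
  LinearIsometry.norm_map ((phaseMul (weylPhase r) (continuous_weylPhase r)
    (norm_weylPhase r)).comp (translation (momentumPart r))) ψ

theorem inner_displacement {m : ℕ} (r : PhaseSpace m) (φ ψ : ModeSpace m) :
    ⟪displacement r φ, displacement r ψ⟫_ℂ = ⟪φ, ψ⟫_ℂ :=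
  LinearIsometry.inner_map_map ((phaseMul (weylPhase r) (continuous_weylPhase r)
    (norm_weylPhase r)).comp (translation (momentumPart r))) φ ψ

/-- Displacements along one line of phase space form a one-parameter group. -/
theorem displacement_smul_comp {m : ℕ} (s t : ℝ) (r : PhaseSpace m) (ψ : ModeSpace m) :
    displacement (s • r) (displacement (t • r) ψ) = displacement ((s + t) • r) ψ := by
  refine Lp.ext ?_
  have hshift := (measurePreserving_add_right (volume : Measure (Config m))
    (momentumPart (s • r))).quasiMeasurePreserving.ae (displacement_apply_ae (t • r) ψ)
  have hpos : ∀ u : ℝ, positionPart (u • r) = u • positionPart r := fun u => rfl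
  have hmom : ∀ u : ℝ, momentumPart (u • r) = u • momentumPart r := fun u => rfl
  filter_upwards [displacement_apply_ae (s • r) (displacement (t • r) ψ),
    displacement_apply_ae ((s + t) • r) ψ, hshift] with x h1 h2 h3
  rw [h1, h2, h3, ← mul_assoc, hmom, hmom, hmom, add_assoc x, ← add_smul]
  congr 1
  rw [weylPhase, weylPhase, weylPhase, ← Complex.exp_add]
  congr 1
  simp only [hpos, hmom, inner_add_right, inner_smul_left, inner_smul_right, conj_trivial]
  push_cast
  ring

theorem displacement_eq_smul_boost_translation {m : ℕ} (r : PhaseSpace m) (ψ : ModeSpace m) :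
    displacement r ψ =
      Complex.exp (((⟪positionPart r, momentumPart r⟫_ℝ / 2 : ℝ) : ℂ) * Complex.I) •
        boost (positionPart r) (translation (momentumPart r) ψ) := by
  refine Lp.ext ?_
  filter_upwards [displacement_apply_ae r ψ, translation_apply_ae (momentumPart r) ψ,
    boost_apply_ae (positionPart r) (translation (momentumPart r) ψ),
    Lp.coeFn_smul (Complex.exp (((⟪positionPart r, momentumPart r⟫_ℝ / 2 : ℝ) : ℂ) * Complex.I))
      (boost (positionPart r) (translation (momentumPart r) ψ))] with x h1 h2 h3 h4
  rw [h4, Pi.smul_apply, h3, h2, h1, smul_eq_mul, ← mul_assoc, ← Complex.exp_add, weylPhase]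
  congr 2
  push_cast
  ring

theorem displacement_zero {m : ℕ} (ψ : ModeSpace m) : displacement 0 ψ = ψ := by
  refine Lp.ext ?_
  have h0 : positionPart (0 : PhaseSpace m) = 0 := rfl
  have h0' : momentumPart (0 : PhaseSpace m) = 0 := rfl
  filter_upwards [displacement_apply_ae 0 ψ] with x h1
  rw [h1, weylPhase, h0, h0']
  simp

theorem norm_exp_half_inner_sub_one_le {m : ℕ} (r : PhaseSpace m) :
    ‖Complex.exp (((⟪positionPart r, momentumPart r⟫_ℝ / 2 : ℝ) : ℂ) * Complex.I) - 1‖ ≤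
      ‖r‖ ^ 2 := by
  refine (norm_exp_mul_I_sub_one_le_abs _).trans ?_
  have h := abs_real_inner_le_norm (positionPart r) (momentumPart r)
  have h2 := mul_le_mul (norm_positionPart_le r) (norm_momentumPart_le r) (norm_nonneg _)
    (norm_nonneg _)
  rw [abs_div, abs_two]
  nlinarith [abs_nonneg ⟪positionPart r, momentumPart r⟫_ℝ]

section Domain

variable {m : ℕ} {ψ : ModeSpace m} {q : Fin m × Fin 2 → ModeSpace m}

theorem mem_positionGraph_of_mem_quadratureGraph (hq : ∀ k, (ψ, q k) ∈ quadratureGraph k)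
    (j : Fin m) : (ψ, q (j, 0)) ∈ positionGraph j := by
  simpa [quadratureGraph] using hq (j, 0)

theorem mem_momentumGraph_of_mem_quadratureGraph (hq : ∀ k, (ψ, q k) ∈ quadratureGraph k)
    (j : Fin m) : (ψ, q (j, 1)) ∈ momentumGraph j := by
  simpa [quadratureGraph] using hq (j, 1)

theorem sum_quadrature_eq (q : Fin m × Fin 2 → ModeSpace m) (r : PhaseSpace m) :
    ∑ k, (r k : ℂ) • q k = (∑ j, (positionPart r j : ℂ) • q (j, 0)) +
      ∑ j, (momentumPart r j : ℂ) • q (j, 1) := by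
  rw [Fintype.sum_prod_type, ← Finset.sum_add_distrib]
  refine Finset.sum_congr rfl fun j _ => ?_
  rw [Fin.sum_univ_two]
  rfl

theorem norm_sum_smul_le {ι : Type*} [Fintype ι] (c : EuclideanSpace ℝ ι) {E : Type*}
    [NormedAddCommGroup E] [NormedSpace ℂ E] (q : ι → E) :
    ‖∑ k, (c k : ℂ) • q k‖ ≤ ‖c‖ * ∑ k, ‖q k‖ := by
  rw [Finset.mul_sum]
  refine (norm_sum_le _ _).trans (Finset.sum_le_sum fun k _ => ?_)
  rw [norm_smul, Complex.norm_real]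
  exact mul_le_mul_of_nonneg_right (PiLp.norm_apply_le c k) (norm_nonneg _)

/-- The constant is explicit so that it can be summed over the vectors `√τ e_i`. -/
theorem norm_displacement_sub_le (hq : ∀ k, (ψ, q k) ∈ quadratureGraph k) {r : PhaseSpace m}
    (hr : ‖r‖ ≤ 1) : ‖displacement r ψ - ψ‖ ≤ (‖ψ‖ + ∑ k, ‖q k‖) * ‖r‖ := by
  set a := positionPart r
  set b := momentumPart r
  set c := Complex.exp (((⟪a, b⟫_ℝ / 2 : ℝ) : ℂ) * Complex.I)
  have hT := (isWeakMomentum_sum (mem_momentumGraph_of_mem_quadratureGraph hq)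
    b).norm_translation_sub_le.trans (norm_sum_smul_le b _)
  have hM := (norm_boost_sub_le (mem_positionGraph_of_mem_quadratureGraph hq) a).trans
    (norm_sum_smul_le a _)
  have hsplit : displacement r ψ - ψ = (c - 1) • boost a (translation b ψ) +
      boost a (translation b ψ - ψ) + (boost a ψ - ψ) := by
    rw [displacement_eq_smul_boost_translation, map_sub, sub_smul, one_smul]
    abel
  have hc1 : ‖(c - 1) • boost a (translation b ψ)‖ ≤ ‖r‖ * ‖ψ‖ := by
    rw [norm_smul, LinearIsometry.norm_map, LinearIsometry.norm_map]
    refine mul_le_mul_of_nonneg_right ((norm_exp_half_inner_sub_one_le r).trans ?_)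
      (norm_nonneg _)
    nlinarith [norm_nonneg r]
  have hsum : ∑ k, ‖q k‖ = (∑ j, ‖q (j, 0)‖) + ∑ j, ‖q (j, 1)‖ := by
    rw [Fintype.sum_prod_type, ← Finset.sum_add_distrib]
    exact Finset.sum_congr rfl fun j _ => Fin.sum_univ_two _
  have hA : ‖a‖ * (∑ j, ‖q (j, 0)‖) ≤ ‖r‖ * ∑ j, ‖q (j, 0)‖ := by
    gcongr
    exact norm_positionPart_le r
  have hB : ‖b‖ * (∑ j, ‖q (j, 1)‖) ≤ ‖r‖ * ∑ j, ‖q (j, 1)‖ := by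
    gcongr
    exact norm_momentumPart_le r
  rw [hsplit, hsum]
  refine norm_add₃_le.trans ?_
  rw [LinearIsometry.norm_map]
  linarith

/-- First order expansion `D_r ψ = ψ + i r ⬝ Q ψ + o(|r|)` on the domain of all quadratures. -/
theorem displacement_sub_isLittleO (hq : ∀ k, (ψ, q k) ∈ quadratureGraph k) :
    (fun r : PhaseSpace m => displacement r ψ - ψ - Complex.I • ∑ k, (r k : ℂ) • q k)
      =o[𝓝 0] fun r => r := by
  have ha : (fun r : PhaseSpace m => positionPart r) =O[𝓝 0] fun r => r :=
    isBigO_of_le _ norm_positionPart_le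
  have hb : (fun r : PhaseSpace m => momentumPart r) =O[𝓝 0] fun r => r :=
    isBigO_of_le _ norm_momentumPart_le
  have hta : Tendsto (fun r : PhaseSpace m => positionPart r) (𝓝 0) (𝓝 0) :=
    ha.trans_tendsto tendsto_id
  have htb : Tendsto (fun r : PhaseSpace m => momentumPart r) (𝓝 0) (𝓝 0) :=
    hb.trans_tendsto tendsto_id
  have h1 : (fun r : PhaseSpace m =>
      (Complex.exp (((⟪positionPart r, momentumPart r⟫_ℝ / 2 : ℝ) : ℂ) * Complex.I) - 1) •
        boost (positionPart r) (translation (momentumPart r) ψ)) =o[𝓝 0] fun r => r := by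
    have hO : (fun r : PhaseSpace m =>
        (Complex.exp (((⟪positionPart r, momentumPart r⟫_ℝ / 2 : ℝ) : ℂ) * Complex.I) - 1) •
          boost (positionPart r) (translation (momentumPart r) ψ))
        =O[𝓝 0] fun r => ‖r‖ ^ 2 := by
      refine IsBigO.of_bound ‖ψ‖ (Eventually.of_forall fun r => ?_)
      rw [norm_smul, LinearIsometry.norm_map, LinearIsometry.norm_map, norm_pow, norm_norm,
        mul_comm]
      exact mul_le_mul_of_nonneg_left (norm_exp_half_inner_sub_one_le r) (norm_nonneg _)
    exact hO.trans_isLittleO (isLittleO_norm_pow_id one_lt_two)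
  have h2 : (fun r : PhaseSpace m => boost (positionPart r)
      (translation (momentumPart r) ψ - ψ -
        Complex.I • ∑ j, (momentumPart r j : ℂ) • q (j, 1))) =o[𝓝 0] fun r => r := by
    rw [← isLittleO_norm_left]
    simp_rw [LinearIsometry.norm_map]
    rw [isLittleO_norm_left]
    exact ((translation_sub_isLittleO
      (mem_momentumGraph_of_mem_quadratureGraph hq)).comp_tendsto htb).trans_isBigO hb
  have h3 : (fun r : PhaseSpace m => Complex.I • ∑ j, (momentumPart r j : ℂ) •
      (boost (positionPart r) (q (j, 1)) - q (j, 1))) =o[𝓝 0] fun r => r := by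
    refine (isLittleO_const_smul_left Complex.I_ne_zero).2 (IsLittleO.fun_sum fun j _ => ?_)
    have hbj : (fun r : PhaseSpace m => (momentumPart r j : ℂ)) =O[𝓝 0] fun r => ‖r‖ := by
      refine isBigO_of_le _ fun r => ?_
      rw [Complex.norm_real, norm_norm]
      exact (PiLp.norm_apply_le _ j).trans (norm_momentumPart_le r)
    have hq1 : (fun r : PhaseSpace m => boost (positionPart r) (q (j, 1)) - q (j, 1))
        =o[𝓝 0] fun _ => (1 : ℝ) :=
      (isLittleO_one_iff ℝ).2 ((tendsto_boost_sub (q (j, 1))).comp hta)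
    rw [← isLittleO_norm_right]
    simpa using hbj.smul_isLittleO hq1
  have h4 : (fun r : PhaseSpace m => boost (positionPart r) ψ - ψ -
      Complex.I • ∑ j, (positionPart r j : ℂ) • q (j, 0)) =o[𝓝 0] fun r => r :=
    ((boost_sub_isLittleO (mem_positionGraph_of_mem_quadratureGraph hq)).comp_tendsto
      hta).trans_isBigO ha
  -- The four terms come from the scalar phase, the remainder of the translation, the failure of the
  -- plane wave to fix its derivative, and the remainder of the plane wave.
  refine (((h1.add h2).add h3).add h4).congr_left fun r => ?_
  rw [displacement_eq_smul_boost_translation, sum_quadrature_eq]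
  simp only [map_sub, map_sum, map_smul, smul_sub, sub_smul, one_smul, smul_add,
    Finset.sum_sub_distrib]
  abel

end Domain

/-! ### Second order expansion of a matrix coefficient -/

/-- A function that is `o(|v|)` and satisfies `h(2v) = 2 h(v) + o(|v|²)` is `o(|v|²)`: write
`h(v) = ∑ₖ 2ᵏ (h(v / 2ᵏ) - 2 h(v / 2ᵏ⁺¹))`, which is dominated by a geometric series. -/
theorem isLittleO_sq_of_isLittleO_double_sub {V : Type*} [NormedAddCommGroup V] [NormedSpace ℝ V]
    {h : V → ℝ} (h1 : h =o[𝓝 0] fun v => v)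
    (h2 : (fun v => h (v + v) - 2 * h v) =o[𝓝 0] fun v => ‖v‖ ^ 2) :
    h =o[𝓝 0] fun v => ‖v‖ ^ 2 := by
  rw [isLittleO_iff]
  intro c hc
  obtain ⟨δ, hδ, hball⟩ := Metric.eventually_nhds_iff_ball.1 (isLittleO_iff.1 h2 hc)
  filter_upwards [Metric.ball_mem_nhds 0 hδ] with v hv
  rw [mem_ball_zero_iff] at hv
  -- The telescoping sum down to scale `2⁻ⁿ`; its second summand vanishes in the limit.
  have hstep : ∀ n : ℕ,
      |h v| ≤ (1 - (1 / 2 : ℝ) ^ n) * (c * ‖v‖ ^ 2) + 2 ^ n * |h ((1 / 2 : ℝ) ^ n • v)| := by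
    intro n
    induction n with
    | zero => simp
    | succ n ih =>
      set w := (1 / 2 : ℝ) ^ (n + 1) • v with hw
      have hwn : ‖w‖ = (1 / 2 : ℝ) ^ (n + 1) * ‖v‖ := by
        rw [hw, norm_smul, Real.norm_of_nonneg (by positivity)]
      have hww : (1 / 2 : ℝ) ^ n • v = w + w := by
        rw [hw, ← add_smul]
        congr 1
        ring
      have hwb : w ∈ Metric.ball (0 : V) δ := by
        rw [mem_ball_zero_iff, hwn]
        refine (mul_le_of_le_one_left (norm_nonneg _) ?_).trans_lt hv
        exact pow_le_one₀ (by norm_num) (by norm_num)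
      have hE := hball w hwb
      rw [Real.norm_eq_abs, norm_pow, norm_norm, hwn] at hE
      have habs : |h (w + w)| ≤ |h (w + w) - 2 * h w| + 2 * |h w| := by
        have := abs_add_le (h (w + w) - 2 * h w) (2 * h w)
        rwa [sub_add_cancel, abs_mul, abs_two] at this
      have hp : (2 : ℝ) ^ n * (1 / 2 : ℝ) ^ n = 1 := by
        rw [← mul_pow]
        norm_num
      have hX : 0 ≤ c * ‖v‖ ^ 2 := by positivity
      have hY : 0 ≤ (1 / 2 : ℝ) ^ n * (c * ‖v‖ ^ 2) := by positivity
      rw [hww] at ih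
      calc |h v| ≤ (1 - (1 / 2 : ℝ) ^ n) * (c * ‖v‖ ^ 2) + 2 ^ n * |h (w + w)| := ih
        _ ≤ (1 - (1 / 2 : ℝ) ^ n) * (c * ‖v‖ ^ 2) +
            2 ^ n * (c * ((1 / 2 : ℝ) ^ (n + 1) * ‖v‖) ^ 2 + 2 * |h w|) := by
            gcongr
            exact habs.trans (by gcongr)
        _ = (1 - (1 / 2 : ℝ) ^ n) * (c * ‖v‖ ^ 2) +
            (2 ^ n * (1 / 2 : ℝ) ^ n) * ((1 / 2 : ℝ) ^ n * (c * ‖v‖ ^ 2) / 4) +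
            2 ^ (n + 1) * |h w| := by ring
        _ ≤ (1 - (1 / 2 : ℝ) ^ (n + 1)) * (c * ‖v‖ ^ 2) + 2 ^ (n + 1) * |h w| := by
            rw [hp, pow_succ (1 / 2 : ℝ) n]
            linarith
  rcases eq_or_ne v 0 with rfl | -
  · have := (isLittleO_iff.1 h1 one_pos).self_of_nhds
    simp only [norm_zero, mul_zero] at this
    simpa using this
  have hlim : Tendsto (fun n : ℕ => (2 : ℝ) ^ n * |h ((1 / 2 : ℝ) ^ n • v)|) atTop (𝓝 0) := by
    have hg : Tendsto (fun n : ℕ => (1 / 2 : ℝ) ^ n • v) atTop (𝓝 0) := by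
      simpa using (tendsto_pow_atTop_nhds_zero_of_lt_one (r := (1 / 2 : ℝ)) (by norm_num)
        (by norm_num)).smul_const v
    have hO : (fun n : ℕ => (1 / 2 : ℝ) ^ n • v) =O[atTop] fun n => (1 / 2 : ℝ) ^ n := by
      refine IsBigO.of_bound ‖v‖ (Eventually.of_forall fun n => ?_)
      rw [norm_smul, mul_comm]
    have := ((h1.comp_tendsto hg).trans_isBigO hO).tendsto_div_nhds_zero.abs
    rw [abs_zero] at this
    refine this.congr fun n => ?_
    have hinv : ((1 / 2 : ℝ) ^ n)⁻¹ = 2 ^ n := by rw [one_div, inv_pow, inv_inv]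
    rw [abs_div, abs_of_pos (a := (1 / 2 : ℝ) ^ n) (by positivity), div_eq_mul_inv, hinv, mul_comm]
    rfl
  have hp : Tendsto (fun n : ℕ => (1 / 2 : ℝ) ^ n) atTop (𝓝 0) :=
    tendsto_pow_atTop_nhds_zero_of_lt_one (by norm_num) (by norm_num)
  have := ge_of_tendsto
    ((((tendsto_const_nhds (x := (1 : ℝ))).sub hp).mul_const (c * ‖v‖ ^ 2)).add hlim)
    (Eventually.of_forall hstep)
  simpa using this

/-- Second order expansion of the matrix coefficient `⟨Φ 0, Φ s⟩` of a unitary family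
`Φ s = U_s (Φ 0)` that is differentiable at the origin, with derivative `i A` and `⟨Φ 0, A s⟩`
imaginary. The hypotheses `hnorm`, `hneg`, `hdouble` are what is needed of `U` being unitary and a
one-parameter group on every line. -/
theorem inner_sub_isLittleO_sq {V K : Type*} [NormedAddCommGroup V] [NormedSpace ℝ V]
    [NormedAddCommGroup K] [InnerProductSpace ℂ K] {Φ A : V → K}
    (hnorm : ∀ s, ‖Φ s‖ = ‖Φ 0‖)
    (hneg : ∀ s, ⟪Φ 0, Φ (-s)⟫_ℂ = ⟪Φ s, Φ 0⟫_ℂ)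
    (hdouble : ∀ s, ⟪Φ (-s), Φ s⟫_ℂ = ⟪Φ 0, Φ (s + s)⟫_ℂ)
    (hAneg : ∀ s, A (-s) = -A s) (hA : A =O[𝓝 0] fun s => s)
    (hΦ : (fun s => Φ s - Φ 0 - Complex.I • A s) =o[𝓝 0] fun s => s)
    (hre : ∀ s, (⟪Φ 0, A s⟫_ℂ).re = 0) :
    (fun s => ⟪Φ 0, Φ s⟫_ℂ - ((‖Φ 0‖ ^ 2 - ‖A s‖ ^ 2 / 2 : ℝ) : ℂ))
      =o[𝓝 0] fun s => ‖s‖ ^ 2 := by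
  have hIA : (fun s => Complex.I • A s) =O[𝓝 0] fun s => s := hA.const_smul_left _
  have hX : (fun s => Φ s - Φ 0) =O[𝓝 0] fun s => s :=
    (hΦ.isBigO.add hIA).congr_left fun s => sub_add_cancel _ _
  have hinner : ∀ {f g : V → K}, f =O[𝓝 0] (fun s => s) → g =o[𝓝 0] (fun s => s) →
      (fun s => ‖f s‖ * ‖g s‖) =o[𝓝 0] fun s => ‖s‖ ^ 2 := fun hf hg => by
    simpa only [sq] using hf.norm_norm.mul_isLittleO hg.norm_norm
  have hRe : (fun s => (⟪Φ 0, Φ s⟫_ℂ).re - (‖Φ 0‖ ^ 2 - ‖A s‖ ^ 2 / 2))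
      =o[𝓝 0] fun s => ‖s‖ ^ 2 := by
    refine IsBigO.trans_isLittleO (IsBigO.of_bound 1 (Eventually.of_forall fun s => ?_))
      ((hinner hX hΦ).add (hinner hIA hΦ))
    have h1 := norm_sub_sq (𝕜 := ℂ) (Φ s) (Φ 0)
    rw [hnorm s, ← inner_conj_symm] at h1
    simp only [RCLike.conj_re, RCLike.re_to_complex] at h1
    have h2 : ‖Complex.I • A s‖ = ‖A s‖ := by rw [norm_smul, Complex.norm_I, one_mul]
    have h3 := abs_norm_sub_norm_le (Φ s - Φ 0) (Complex.I • A s)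
    have h4 : (⟪Φ 0, Φ s⟫_ℂ).re - (‖Φ 0‖ ^ 2 - ‖A s‖ ^ 2 / 2) =
        -((‖Φ s - Φ 0‖ - ‖Complex.I • A s‖) * (‖Φ s - Φ 0‖ + ‖Complex.I • A s‖)) / 2 := by
      rw [h2]
      linarith
    rw [h4, Real.norm_eq_abs, abs_div, abs_neg, abs_mul, abs_two,
      abs_of_nonneg (a := ‖Φ s - Φ 0‖ + ‖Complex.I • A s‖) (by positivity), ← add_mul,
      Real.norm_of_nonneg (by positivity), one_mul, mul_comm (_ + _)]
    have h5 := mul_le_mul_of_nonneg_right h3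
      (show 0 ≤ ‖Φ s - Φ 0‖ + ‖Complex.I • A s‖ by positivity)
    have h6 : 0 ≤ ‖Φ s - Φ 0 - Complex.I • A s‖ * (‖Φ s - Φ 0‖ + ‖Complex.I • A s‖) := by
      positivity
    linarith
  have hIm1 : (fun s => (⟪Φ 0, Φ s⟫_ℂ).im) =o[𝓝 0] fun s => s := by
    refine IsBigO.trans_isLittleO (IsBigO.of_bound ‖Φ 0‖ (Eventually.of_forall fun s => ?_)) hΦ
    have h1 : (⟪Φ 0, Φ s⟫_ℂ).im = (⟪Φ 0, Φ s - Φ 0 - Complex.I • A s⟫_ℂ).im := by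
      have h0 : (⟪Φ 0, Φ 0⟫_ℂ).im = 0 := inner_self_im (𝕜 := ℂ) (Φ 0)
      rw [inner_sub_right, inner_sub_right, inner_smul_right, Complex.sub_im, Complex.sub_im, h0,
        Complex.I_mul_im, hre s]
      ring
    rw [h1, Real.norm_eq_abs]
    exact (Complex.abs_im_le_norm _).trans (norm_inner_le_norm _ _)
  have hIm2 : (fun s => (⟪Φ 0, Φ (s + s)⟫_ℂ).im - 2 * (⟪Φ 0, Φ s⟫_ℂ).im)
      =o[𝓝 0] fun s => ‖s‖ ^ 2 := by
    have hnegt : Tendsto (fun s : V => -s) (𝓝 0) (𝓝 0) := by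
      simpa using (continuous_neg (G := V)).tendsto 0
    have hΦ' : (fun s => Φ (-s) - Φ 0 + Complex.I • A s) =o[𝓝 0] fun s => s := by
      have := (hΦ.comp_tendsto hnegt).trans_isBigO
        (isBigO_of_le (𝓝 0) (g := fun s : V => s) fun s => (norm_neg s).le)
      refine this.congr_left fun s => ?_
      simp [hAneg]
    refine IsBigO.trans_isLittleO (IsBigO.of_bound 1 (Eventually.of_forall fun s => ?_))
      ((hinner hX hΦ').add (hinner hIA hΦ))
    -- The second order terms of the expansion cancel up to the real number `‖A s‖²`.
    have h1 : (⟪Φ 0, Φ (s + s)⟫_ℂ).im - 2 * (⟪Φ 0, Φ s⟫_ℂ).im =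
        (⟪Φ (-s) - Φ 0 + Complex.I • A s, Φ s - Φ 0⟫_ℂ).im -
          (⟪Complex.I • A s, Φ s - Φ 0 - Complex.I • A s⟫_ℂ).im := by
      have h0 : (⟪Φ 0, Φ 0⟫_ℂ).im = 0 := inner_self_im (𝕜 := ℂ) (Φ 0)
      have h0' : (⟪Complex.I • A s, Complex.I • A s⟫_ℂ).im = 0 := inner_self_im (𝕜 := ℂ) _
      have hn : (⟪Φ (-s), Φ 0⟫_ℂ).im = (⟪Φ 0, Φ s⟫_ℂ).im := by
        rw [← inner_conj_symm, hneg, ← inner_conj_symm (Φ s), Complex.conj_conj]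
      rw [← hdouble]
      simp only [inner_sub_left, inner_sub_right, inner_add_left, Complex.sub_im, Complex.add_im,
        h0, h0', hn]
      ring
    rw [h1, one_mul, Real.norm_eq_abs, Real.norm_of_nonneg (by positivity)]
    refine (abs_sub _ _).trans (add_le_add ?_ ?_)
    · rw [mul_comm]
      exact (Complex.abs_im_le_norm _).trans (norm_inner_le_norm _ _)
    · exact (Complex.abs_im_le_norm _).trans (norm_inner_le_norm _ _)
  have hIm := isLittleO_sq_of_isLittleO_double_sub hIm1 hIm2
  refine IsBigO.trans_isLittleO (IsBigO.of_bound 1 (Eventually.of_forall fun s => ?_))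
    (hRe.norm_left.add hIm.norm_left)
  rw [one_mul, Real.norm_of_nonneg (by positivity)]
  refine (Complex.norm_le_abs_re_add_abs_im _).trans (le_of_eq ?_)
  rw [Complex.sub_re, Complex.sub_im, Complex.ofReal_re, Complex.ofReal_im, sub_zero]
  rfl

/-! ### Square-summable families -/

/-- Dominated convergence for curves in a Hilbert sum. -/
theorem lp_isLittleO_of_forall {ι V E : Type*} [NormedAddCommGroup V] [NormedAddCommGroup E]
    {R : V → lp (fun _ : ι => E) 2} {B : ι → ℝ} (hB0 : ∀ i, 0 ≤ B i)
    (hB : Summable fun i => B i ^ 2)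
    (hle : ∀ᶠ v in 𝓝 0, ∀ i, ‖R v i‖ ≤ B i * ‖v‖)
    (hR : ∀ i, (fun v => R v i) =o[𝓝 0] fun v => v) :
    R =o[𝓝 0] fun v => v := by
  have hnorm : ∀ v, ‖R v‖ ^ 2 = ∑' i, ‖R v i‖ ^ 2 := fun v => by
    have := lp.norm_rpow_eq_tsum (p := 2) (by norm_num) (R v)
    simpa using this
  have hsq : Tendsto (fun v => (‖R v‖ / ‖v‖) ^ 2) (𝓝 0) (𝓝 0) := by
    have := tendsto_tsum_of_dominated_convergence (𝓕 := 𝓝 (0 : V))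
      (f := fun v i => (‖R v i‖ / ‖v‖) ^ 2) (g := fun _ => 0) hB (fun i => by
        have := (hR i).norm_norm.tendsto_div_nhds_zero
        simpa using this.pow 2) (hle.mono fun v hv i => by
        rw [Real.norm_of_nonneg (by positivity)]
        refine pow_le_pow_left₀ (by positivity) ?_ 2
        rcases eq_or_ne ‖v‖ 0 with h0 | h0
        · rw [h0, div_zero]
          exact hB0 i
        · rw [div_le_iff₀ (lt_of_le_of_ne (norm_nonneg _) h0.symm)]
          exact hv i)
    rw [tsum_zero] at this
    refine this.congr fun v => ?_
    simp_rw [div_pow]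
    rw [hnorm, tsum_div_const]
  have hlim : Tendsto (fun v => ‖R v‖ / ‖v‖) (𝓝 0) (𝓝 0) := by
    have := hsq.sqrt
    rw [Real.sqrt_zero] at this
    exact this.congr fun v => Real.sqrt_sq (by positivity)
  refine ((isLittleO_iff_tendsto fun v hv => ?_).2 hlim).of_norm_norm
  rw [norm_eq_zero] at hv
  subst hv
  rw [norm_eq_zero]
  ext i
  simpa using hle.self_of_nhds i

/-! ### Cyclicity of the trace -/

section Trace

variable {ι H : Type*} [NormedAddCommGroup H] [InnerProductSpace ℂ H]

theorem hasSum_norm_inner_sq (b : HilbertBasis ι ℂ H) (x : H) :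
    HasSum (fun i => ‖⟪b i, x⟫_ℂ‖ ^ 2) (‖x‖ ^ 2) := by
  have h := Complex.hasSum_re (b.hasSum_inner_mul_inner x x)
  have h0 : (⟪x, x⟫_ℂ).re = ‖x‖ ^ 2 := (norm_sq_eq_re_inner (𝕜 := ℂ) x).symm
  rw [h0] at h
  convert h using 2 with i
  rw [← inner_conj_symm x (b i), Complex.conj_mul', ← Complex.ofReal_pow, Complex.ofReal_re]

theorem summable_norm_inner_sq (b : HilbertBasis ι ℂ H) {f : ι → H}
    (hf : Summable fun i => ‖f i‖ ^ 2) :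
    Summable fun p : ι × ι => ‖⟪b p.2, f p.1⟫_ℂ‖ ^ 2 := by
  refine (summable_prod_of_nonneg fun p => by positivity).2
    ⟨fun i => (hasSum_norm_inner_sq b (f i)).summable, ?_⟩
  simpa only [(hasSum_norm_inner_sq b (f _)).tsum_eq] using hf

/-- Cyclicity `tr(A S) = tr(S A)` for Hilbert–Schmidt operators, `S` being symmetric: both sides
are iterated sums of the absolutely summable family `⟨e_i, A e_j⟩ ⟨e_j, S e_i⟩`. -/
theorem tsum_inner_comp_eq [CompleteSpace H] (b : HilbertBasis ι ℂ H) {S A : H →L[ℂ] H}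
    (hS : ∀ x y, ⟪S x, y⟫_ℂ = ⟪x, S y⟫_ℂ) (hS2 : Summable fun i => ‖S (b i)‖ ^ 2)
    (hA2 : Summable fun i => ‖A (b i)‖ ^ 2) :
    ∑' i, ⟪b i, A (S (b i))⟫_ℂ = ∑' i, ⟪S (b i), A (b i)⟫_ℂ := by
  have hrow : ∀ i, ∑' j, ⟪b i, A (b j)⟫_ℂ * ⟪b j, S (b i)⟫_ℂ = ⟪b i, A (S (b i))⟫_ℂ := fun i => by
    simp_rw [← ContinuousLinearMap.adjoint_inner_left A]
    exact b.tsum_inner_mul_inner _ _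
  have hcol : ∀ j, ∑' i, ⟪b i, A (b j)⟫_ℂ * ⟪b j, S (b i)⟫_ℂ = ⟪S (b j), A (b j)⟫_ℂ := fun j => by
    rw [← b.tsum_inner_mul_inner]
    exact tsum_congr fun i => by rw [hS, mul_comm]
  have hsum : Summable (Function.uncurry fun i j => ⟪b i, A (b j)⟫_ℂ * ⟪b j, S (b i)⟫_ℂ) := by
    have h1 := (summable_norm_inner_sq b hA2).prod_symm
    refine Summable.of_norm_bounded (h1.add (summable_norm_inner_sq b hS2)) fun p => ?_
    show ‖⟪b p.1, A (b p.2)⟫_ℂ * ⟪b p.2, S (b p.1)⟫_ℂ‖ ≤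
      ‖⟪b p.1, A (b p.2)⟫_ℂ‖ ^ 2 + ‖⟪b p.2, S (b p.1)⟫_ℂ‖ ^ 2
    rw [norm_mul]
    nlinarith [sq_nonneg (‖⟪b p.1, A (b p.2)⟫_ℂ‖ - ‖⟪b p.2, S (b p.1)⟫_ℂ‖),
      mul_nonneg (norm_nonneg ⟪b p.1, A (b p.2)⟫_ℂ) (norm_nonneg ⟪b p.2, S (b p.1)⟫_ℂ)]
  rw [← tsum_congr hrow, ← tsum_congr hcol]
  exact (hsum.tsum_comm).symm

end Trace

/-! ### Expansion of the characteristic function of a state -/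

theorem mem_quadratureGraph_of_mem_domain {m : ℕ} {k : Fin m × Fin 2} {ψ : ModeSpace m}
    (h : ψ ∈ (quadrature k).domain) : (ψ, applyQuadrature k ψ) ∈ quadratureGraph k := by
  rw [applyQuadrature, dif_pos h]
  exact Submodule.mem_graph_toLinearPMap (quadratureGraph_singleValued k) ⟨ψ, h⟩

theorem inner_opSqrt_left {m : ℕ} (τ : ModeSpace m →L[ℂ] ModeSpace m) (x y : ModeSpace m) :
    ⟪opSqrt τ x, y⟫_ℂ = ⟪x, opSqrt τ y⟫_ℂ :=
  (opSqrt_isPositive τ).isSymmetric x y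

theorem IsState.hasSum_norm_opSqrt_sq {m : ℕ} {τ : ModeSpace m →L[ℂ] ModeSpace m}
    (hτ : IsState τ) : HasSum (fun i => ‖opSqrt τ (stdBasis m i)‖ ^ 2) 1 := by
  have h := Complex.hasSum_re hτ.2
  rw [Complex.one_re] at h
  convert h using 2 with i
  conv_rhs => rw [← opSqrt_comp_self hτ.1]
  rw [ContinuousLinearMap.comp_apply, ← inner_opSqrt_left]
  exact norm_sq_eq_re_inner (𝕜 := ℂ) (opSqrt τ (stdBasis m i))

theorem IsState.charFn_eq_tsum {m : ℕ} {τ : ModeSpace m →L[ℂ] ModeSpace m}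
    (hτ : IsState τ) (r : PhaseSpace m) :
    charFn τ r = ∑' i, ⟪opSqrt τ (stdBasis m i), displacement r (opSqrt τ (stdBasis m i))⟫_ℂ := by
  have hS := hτ.hasSum_norm_opSqrt_sq.summable
  have h := tsum_inner_comp_eq (stdBasis m) (A := displacement r ∘L opSqrt τ)
    (inner_opSqrt_left τ) hS (by simpa only [ContinuousLinearMap.comp_apply, norm_displacement])
  rw [charFn, trace]
  conv_lhs => rw [← opSqrt_comp_self hτ.1]
  exact h

theorem memℓp_two_of_summable {ι E : Type*} [NormedAddCommGroup E] {f : ι → E}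
    (hf : Summable fun i => ‖f i‖ ^ 2) : Memℓp (E := fun _ : ι => E) f 2 :=
  memℓp_gen (by simpa using hf)

theorem norm_sum_smul_sq {ι K : Type*} [Fintype ι] [NormedAddCommGroup K] [InnerProductSpace ℂ K]
    (Q : ι → K) (c : ι → ℝ) :
    ‖∑ k, (c k : ℂ) • Q k‖ ^ 2 = ∑ j, ∑ k, c j * (⟪Q j, Q k⟫_ℂ).re * c k := by
  have h : ‖∑ k, (c k : ℂ) • Q k‖ ^ 2 = (⟪∑ k, (c k : ℂ) • Q k, ∑ k, (c k : ℂ) • Q k⟫_ℂ).re :=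
    norm_sq_eq_re_inner (𝕜 := ℂ) _
  rw [h, sum_inner, Complex.re_sum]
  refine Finset.sum_congr rfl fun j _ => ?_
  rw [inner_sum, Complex.re_sum]
  refine Finset.sum_congr rfl fun k _ => ?_
  rw [inner_smul_left, inner_smul_right, Complex.conj_ofReal, Complex.re_ofReal_mul,
    Complex.re_ofReal_mul]
  ring

/-- Second order expansion at the origin: the characteristic function of a centered state with
finite second moments agrees with the Gaussian one up to `o(|r|²)`. Nonnegativity of the covariance
matrix is included because it comes from the same vectors: `rᵀ Γ r = 2 ∑_i |r ⬝ Q √τ e_i|²`. -/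
theorem charFn_sub_gaussianCharFn_isLittleO {m : ℕ} {τ : ModeSpace m →L[ℂ] ModeSpace m}
    (hτ : IsState τ) (h2 : HasFiniteSecondMoments τ) (h1 : ∀ k, firstMoment τ k = 0) :
    (∀ r : PhaseSpace m, 0 ≤ ∑ j, ∑ k, r j * covarianceMatrix τ j k * r k) ∧
    (fun r => charFn τ r - gaussianCharFn 0 (covarianceMatrix τ) r)
      =o[𝓝 0] fun r : PhaseSpace m => ‖r‖ ^ 2 := by
  set ψ := fun i => opSqrt τ (stdBasis m i)
  set q := fun i k => applyQuadrature k (ψ i)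
  have hmem : ∀ i k, (ψ i, q i k) ∈ quadratureGraph k := fun i k =>
    mem_quadratureGraph_of_mem_domain ((h2 k).1 _)
  have hψ2 : HasSum (fun i => ‖ψ i‖ ^ 2) 1 := hτ.hasSum_norm_opSqrt_sq
  have hq2 : ∀ k, Summable fun i => ‖q i k‖ ^ 2 := fun k => (h2 k).2
  let Φ : PhaseSpace m → lp (fun _ : basisIndex m => ModeSpace m) 2 := fun r =>
    ⟨fun i => displacement r (ψ i), memℓp_two_of_summable (by
      simpa only [norm_displacement] using hψ2.summable)⟩
  let Q : Fin m × Fin 2 → lp (fun _ : basisIndex m => ModeSpace m) 2 := fun k =>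
    ⟨fun i => q i k, memℓp_two_of_summable (hq2 k)⟩
  set A : PhaseSpace m → lp (fun _ : basisIndex m => ModeSpace m) 2 := fun r =>
    ∑ k, (r k : ℂ) • Q k with hAdef
  have hAi : ∀ r i, A r i = ∑ k, (r k : ℂ) • q i k := fun r i => by
    rw [hAdef]
    simp only [lp.coeFn_sum, Finset.sum_apply, lp.coeFn_smul, Pi.smul_apply]
    rfl
  have hΦ0i : ∀ i, Φ 0 i = ψ i := fun i => displacement_zero (ψ i)
  have hinner : ∀ r s, ⟪Φ r, Φ s⟫_ℂ = ∑' i, ⟪displacement r (ψ i), displacement s (ψ i)⟫_ℂ :=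
    fun r s => lp.inner_eq_tsum _ _
  have hgroup : ∀ (a b c : ℝ) (r : PhaseSpace m),
      ⟪Φ (a • r), Φ (b • r)⟫_ℂ = ⟪Φ ((c + a) • r), Φ ((c + b) • r)⟫_ℂ := fun a b c r => by
    rw [hinner, hinner]
    refine tsum_congr fun i => ?_
    rw [← displacement_smul_comp, ← displacement_smul_comp, inner_displacement]
  have hχ : ∀ r, charFn τ r = ⟪Φ 0, Φ r⟫_ℂ := fun r => by
    rw [hτ.charFn_eq_tsum, hinner]
    simp_rw [displacement_zero]
    rfl
  have hnorm : ∀ r, ‖Φ r‖ ^ 2 = 1 := fun r => by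
    have h : ‖Φ r‖ ^ 2 = (⟪Φ r, Φ r⟫_ℂ).re := norm_sq_eq_re_inner (𝕜 := ℂ) _
    have h' := Complex.hasSum_re (lp.hasSum_inner (𝕜 := ℂ) (Φ r) (Φ r))
    rw [h]
    refine h'.unique ?_
    convert hψ2 using 2 with i
    rw [← norm_displacement r (ψ i)]
    exact (norm_sq_eq_re_inner (𝕜 := ℂ) _).symm
  have hΓ : ∀ j k, covarianceMatrix τ j k = 2 * (⟪Q j, Q k⟫_ℂ).re := fun j k => by
    rw [covarianceMatrix, lp.inner_eq_tsum]
    simp only [centeredQuadrature, h1, Complex.ofReal_zero, zero_smul, sub_zero]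
    rfl
  have hquad : ∀ r : PhaseSpace m,
      ∑ j, ∑ k, r j * covarianceMatrix τ j k * r k = 2 * ‖A r‖ ^ 2 := fun r => by
    rw [hAdef]
    simp only
    rw [norm_sum_smul_sq, Finset.mul_sum]
    refine Finset.sum_congr rfl fun j _ => ?_
    rw [Finset.mul_sum]
    refine Finset.sum_congr rfl fun k _ => ?_
    rw [hΓ]
    ring
  have hA : A =O[𝓝 0] fun r => r := by
    refine IsBigO.of_bound (∑ k, ‖Q k‖) (Eventually.of_forall fun r => ?_)
    rw [mul_comm]
    exact norm_sum_smul_le r Q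
  refine ⟨fun r => by rw [hquad]; positivity, ?_⟩
  have hΦ : (fun r => Φ r - Φ 0 - Complex.I • A r) =o[𝓝 0] fun r => r := by
    have hcoord : ∀ r i, (Φ r - Φ 0 - Complex.I • A r) i =
        displacement r (ψ i) - ψ i - Complex.I • ∑ k, (r k : ℂ) • q i k := fun r i => by
      show displacement r (ψ i) - Φ 0 i - Complex.I • A r i = _
      rw [hAi, hΦ0i]
    refine lp_isLittleO_of_forall (B := fun i => ‖ψ i‖ + 2 * ∑ k, ‖q i k‖)
      (fun i => by positivity) ?_ ?_ fun i => ?_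
    · have hs : Summable fun i => 2 * ‖ψ i‖ ^ 2 +
          8 * ((Finset.univ : Finset (Fin m × Fin 2)).card * ∑ k, ‖q i k‖ ^ 2) :=
        (hψ2.summable.mul_left 2).add
          (((summable_sum fun k _ => hq2 k).mul_left _).mul_left 8)
      refine hs.of_nonneg_of_le (fun i => by positivity) fun i => ?_
      have hcs := sq_sum_le_card_mul_sum_sq (s := Finset.univ) (f := fun k => ‖q i k‖)
      nlinarith [sq_nonneg (‖ψ i‖ - 2 * ∑ k, ‖q i k‖)]
    · filter_upwards [Metric.closedBall_mem_nhds (0 : PhaseSpace m) one_pos] with r hr i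
      rw [mem_closedBall_zero_iff] at hr
      rw [hcoord]
      refine (norm_sub_le _ _).trans ?_
      rw [norm_smul, Complex.norm_I, one_mul]
      have e1 := norm_displacement_sub_le (hmem i) hr
      have e2 := norm_sum_smul_le r (q i)
      linarith
    · simp_rw [hcoord]
      exact displacement_sub_isLittleO (hmem i)
  have hexp := inner_sub_isLittleO_sq (Φ := Φ) (A := A)
    (fun s => by
      rw [← sq_eq_sq₀ (norm_nonneg _) (norm_nonneg _), hnorm, hnorm])
    (fun s => by
      simpa using hgroup 0 (-1) 1 s)
    (fun s => by
      simpa [add_smul] using hgroup (-1) 1 1 s)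
    (fun s => by
      rw [hAdef]
      simp [neg_smul])
    hA hΦ (fun s => by
      rw [hAdef]
      simp only
      rw [inner_sum, Complex.re_sum]
      refine Finset.sum_eq_zero fun k _ => ?_
      have hk : (⟪Φ 0, Q k⟫_ℂ).re = 0 := by
        rw [← h1 k, firstMoment, lp.inner_eq_tsum]
        simp_rw [hΦ0i]
        rfl
      rw [inner_smul_right, Complex.re_ofReal_mul, hk, mul_zero])
  -- The Gaussian `exp(-|A r|² / 2)` has the same expansion.
  have hz : (fun r : PhaseSpace m => -((‖A r‖ ^ 2 / 2 : ℝ) : ℂ)) =O[𝓝 0] fun r => ‖r‖ ^ 2 := by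
    refine IsBigO.trans (IsBigO.of_bound 1 (Eventually.of_forall fun r => ?_))
      (hA.norm_norm.pow 2)
    rw [norm_neg, Complex.norm_real, Real.norm_of_nonneg (by positivity),
      Real.norm_of_nonneg (by positivity)]
    nlinarith [sq_nonneg ‖A r‖]
  have hz0 : Tendsto (fun r : PhaseSpace m => -((‖A r‖ ^ 2 / 2 : ℝ) : ℂ)) (𝓝 0) (𝓝 0) := by
    refine hz.trans_tendsto ?_
    have hc : Continuous fun r : PhaseSpace m => ‖r‖ ^ 2 := by fun_prop
    simpa using hc.tendsto 0
  have hgauss : (fun r : PhaseSpace m => Complex.exp (-((‖A r‖ ^ 2 / 2 : ℝ) : ℂ)) - 1 -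
      -((‖A r‖ ^ 2 / 2 : ℝ) : ℂ)) =o[𝓝 0] fun r => ‖r‖ ^ 2 := by
    have hd := (Complex.hasDerivAt_exp 0).isLittleO
    simp only [Complex.exp_zero, sub_zero, smul_eq_mul, mul_one] at hd
    exact (hd.comp_tendsto hz0).trans_isBigO hz
  refine (hexp.sub hgauss).congr_left fun r => ?_
  have hg : gaussianCharFn 0 (covarianceMatrix τ) r =
      Complex.exp (-((‖A r‖ ^ 2 / 2 : ℝ) : ℂ)) := by
    rw [gaussianCharFn, hquad]
    congr 1
    simp
    ring
  rw [hg, hχ, hnorm]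
  push_cast
  ring

theorem IsState.norm_charFn_le_one {m : ℕ} {τ : ModeSpace m →L[ℂ] ModeSpace m}
    (hτ : IsState τ) (r : PhaseSpace m) : ‖charFn τ r‖ ≤ 1 := by
  rw [hτ.charFn_eq_tsum]
  refine tsum_of_norm_bounded hτ.hasSum_norm_opSqrt_sq fun i => ?_
  refine (norm_inner_le_norm _ _).trans (le_of_eq ?_)
  rw [norm_displacement, sq]

/-! ### The limit theorem -/

theorem norm_pow_sub_pow_le_mul {z w : ℂ} (hz : ‖z‖ ≤ 1) (hw : ‖w‖ ≤ 1) (n : ℕ) :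
    ‖z ^ n - w ^ n‖ ≤ n * ‖z - w‖ := by
  induction n with
  | zero => simp
  | succ n ih =>
    have h : z ^ (n + 1) - w ^ (n + 1) = z * (z ^ n - w ^ n) + (z - w) * w ^ n := by ring
    rw [h]
    refine (norm_add_le _ _).trans ?_
    rw [norm_mul, norm_mul, norm_pow]
    have h1 : ‖z‖ * ‖z ^ n - w ^ n‖ ≤ 1 * (n * ‖z - w‖) :=
      mul_le_mul hz ih (norm_nonneg _) zero_le_one
    have h2 : ‖z - w‖ * ‖w‖ ^ n ≤ ‖z - w‖ * 1 :=
      mul_le_mul_of_nonneg_left (pow_le_one₀ (norm_nonneg _) hw) (norm_nonneg _)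
    push_cast
    linarith

theorem norm_gaussianCharFn_le_one {m : ℕ} {Γ : Matrix (Fin m × Fin 2) (Fin m × Fin 2) ℝ}
    (d r : PhaseSpace m) (hΓ : 0 ≤ ∑ j, ∑ k, r j * Γ j k * r k) : ‖gaussianCharFn d Γ r‖ ≤ 1 := by
  rw [gaussianCharFn, Complex.norm_exp, Real.exp_le_one_iff]
  have h4 : (((∑ j, ∑ k, r j * Γ j k * r k : ℝ) : ℂ) / 4).re =
      (∑ j, ∑ k, r j * Γ j k * r k) / 4 := by
    rw [← Complex.ofReal_ofNat, ← Complex.ofReal_div, Complex.ofReal_re]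
  rw [Complex.sub_re, Complex.I_mul_re, Complex.ofReal_im, h4]
  linarith

/-- A centered Gaussian characteristic function is stable under the central limit scaling. -/
theorem gaussianCharFn_zero_smul_pow {m : ℕ} (Γ : Matrix (Fin m × Fin 2) (Fin m × Fin 2) ℝ)
    {N : ℕ} (hN : 1 ≤ N) (r : PhaseSpace m) :
    gaussianCharFn 0 Γ ((Real.sqrt N)⁻¹ • r) ^ N = gaussianCharFn 0 Γ r := by
  have hN0 : (N : ℝ) ≠ 0 := by positivity
  have hs : (Real.sqrt N)⁻¹ * (Real.sqrt N)⁻¹ * N = 1 := by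
    rw [← mul_inv, Real.mul_self_sqrt (by positivity), inv_mul_cancel₀ hN0]
  have hsum : ∑ j, ∑ k, ((Real.sqrt N)⁻¹ • r) j * Γ j k * ((Real.sqrt N)⁻¹ • r) k =
      (Real.sqrt N)⁻¹ * (Real.sqrt N)⁻¹ * ∑ j, ∑ k, r j * Γ j k * r k := by
    simp_rw [Finset.mul_sum]
    refine Finset.sum_congr rfl fun j _ => Finset.sum_congr rfl fun k _ => ?_
    rw [PiLp.smul_apply, PiLp.smul_apply, smul_eq_mul, smul_eq_mul]
    ring
  rw [gaussianCharFn, gaussianCharFn, ← Complex.exp_nat_mul, hsum]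
  congr 1
  have hsC : ((Real.sqrt N : ℂ))⁻¹ * ((Real.sqrt N : ℂ))⁻¹ * N = 1 := by exact_mod_cast hs
  simp only [PiLp.zero_apply, mul_zero, Finset.sum_const_zero, Complex.ofReal_zero, zero_sub]
  rw [Complex.ofReal_mul, Complex.ofReal_mul, Complex.ofReal_inv]
  linear_combination (-((∑ j, ∑ k, r j * Γ j k * r k : ℝ) : ℂ) / 4) * hsC

end

end QuantumCLT

theorem mainTheorem3 {m : ℕ}
    (τ : ℕ → (QuantumCLT.ModeSpace m →L[ℂ] QuantumCLT.ModeSpace m))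
    (hτ : QuantumCLT.IsCentralLimitSequence τ) :
    ∀ r₀ : ℝ, ∀ ε : ℝ, 0 < ε → ∃ N₀ : ℕ, ∀ N : ℕ, N₀ ≤ N →
      ∀ r : QuantumCLT.PhaseSpace m, ‖r‖ ≤ r₀ →
        ‖QuantumCLT.charFn (τ N) r -
          QuantumCLT.gaussianCharFn 0 (QuantumCLT.covarianceMatrix (τ 1)) r‖ < ε := by
  intro r₀ ε hε
  have hstate := hτ.isState 1 le_rfl
  obtain ⟨hΓ, hexp⟩ := QuantumCLT.charFn_sub_gaussianCharFn_isLittleO hstate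
    hτ.finiteSecondMoments hτ.firstMoment_eq_zero
  -- The `+ 1` keeps the quotient meaningful for `r₀ = 0` and the final inequality strict.
  have hc : 0 < ε / (r₀ ^ 2 + 1) := by positivity
  obtain ⟨δ, hδ, hball⟩ :=
    Metric.eventually_nhds_iff_ball.1 (Asymptotics.isLittleO_iff.1 hexp hc)
  have hlim : Filter.Tendsto (fun N : ℕ => (Real.sqrt N)⁻¹ * r₀) Filter.atTop (nhds 0) := by
    simpa using ((Real.tendsto_sqrt_atTop.comp
      tendsto_natCast_atTop_atTop).inv_tendsto_atTop).mul_const r₀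
  obtain ⟨N₀, hN₀⟩ := Filter.eventually_atTop.1
    ((hlim.eventually_lt_const hδ).and (Filter.eventually_ge_atTop 1))
  refine ⟨N₀, fun N hN r hr => ?_⟩
  obtain ⟨hNδ, hN1⟩ := hN₀ N hN
  have hNpos : (0 : ℝ) < N := by exact_mod_cast hN1
  set s := (Real.sqrt N)⁻¹ • r with hs
  have hsn : ‖s‖ = (Real.sqrt N)⁻¹ * ‖r‖ := by
    rw [hs, norm_smul, Real.norm_of_nonneg (by positivity)]
  have hsball : s ∈ Metric.ball (0 : QuantumCLT.PhaseSpace m) δ := by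
    rw [mem_ball_zero_iff, hsn]
    exact (mul_le_mul_of_nonneg_left hr (by positivity)).trans_lt hNδ
  have hsq : N * ‖s‖ ^ 2 = ‖r‖ ^ 2 := by
    rw [hsn, mul_pow, inv_pow, Real.sq_sqrt hNpos.le, ← mul_assoc, mul_inv_cancel₀ hNpos.ne',
      one_mul]
  have hb := hball s hsball
  rw [norm_pow, norm_norm] at hb
  rw [hτ.charFn_eq N hN1 r, ← QuantumCLT.gaussianCharFn_zero_smul_pow _ hN1 r]
  calc _ ≤ N * ‖QuantumCLT.charFn (τ 1) s -
          QuantumCLT.gaussianCharFn 0 (QuantumCLT.covarianceMatrix (τ 1)) s‖ :=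
        QuantumCLT.norm_pow_sub_pow_le_mul (hstate.norm_charFn_le_one s)
          (QuantumCLT.norm_gaussianCharFn_le_one 0 s (hΓ s)) N
    _ ≤ N * (ε / (r₀ ^ 2 + 1) * ‖s‖ ^ 2) := by gcongr
    _ = ε / (r₀ ^ 2 + 1) * ‖r‖ ^ 2 := by rw [← hsq]; ring
    _ ≤ ε / (r₀ ^ 2 + 1) * r₀ ^ 2 := by gcongr
    _ < ε := by
        rw [div_mul_eq_mul_div, div_lt_iff₀ (by positivity)]
        nlinarith
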